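/- Let $S^1=\mathbb R/2\pi\mathbb Z$ and $d\in\mathbb N$. For $k\in\mathbb Z$ let $H^k(S^1,\mathbb R^d)$ be the Sobolev space of $\mathbb R^d$-valued periodic distributions $u=\sum_{m}\hat u(m)e^{im\theta}$ with $\|u\|_{H^k}^2=\sum_{m\in\mathbb Z}(1+m^2)^k|\hat u(m)|^2<\infty$. For an integer $p\ge 2$ let $\mathrm{Imm}^p(S^1,\mathbb R^2)=\{c\in H^p(S^1,\mathbb R^2): c'(\theta)\ne 0 \text{ for all }\theta\}$, an open subset of $H^p(S^1,\mathbb R^2)$, where $'=\partial_\theta$. For $c\in\mathrm{Imm}^p(S^1,\mathbb R^2)$ let $D_s h=\frac1{|c'|}\,\partial_\theta h$ be the arc length derivative along $c$, and $D_s^* h=-\partial_\theta\big(\frac1{|c'|}h\big)$ its transpose with respect to the $L^2(d\theta)$ pairing. Let $n\ge 2$ and let $a_0,\dots,a_n\ge 0$ be real constants with $a_0\neq 0$ and $a_n\ne 0$. Consider the Sobolev metric of order $n$ with constant coefficients $$G_c(h,k)=\int_{S^1}\sum_{j=0}^n a_j\langle D_s^jh,D_s^jk\rangle\,ds,\qquad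 ds=|c'|\,d\theta,$$ and the associated operator $$\bar L_c=\sum_{j=0}^n a_j\,(D_s^*)^j\circ|c'|\circ D_s^j ,$$ where $|c'|$ stands for multiplication by the function $|c'|$. **Lemma 3.3.** Let $p\ge n$ be an integer. For every $c\in\mathrm{Imm}^p(S^1,\mathbb R^2)$ the operator $$\bar L_c: H^p(S^1,\mathbb R^d)\to H^{p-2n}(S^1,\mathbb R^d)$$ is well defined and an isomorphism of topological vector spaces (linear, bounded and bijective with bounded inverse), and the map $$\mathrm{Imm}^p(S^1,\mathbb R^2)\times H^{p-2n}(S^1,\mathbb R^d)\to H^p(S^1,\mathbb R^d),\qquad (c,h)\mapsto \bar L_c^{-1}h,$$ is smooth ($C^\infty$ in the Fréchet sense). -/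

import Mathlib

open scoped ContDiff ComplexConjugate

noncomputable section

namespace SobolevCurves

/-! The circle is `S¹ = ℝ / 2πℤ`.  A (vector valued) periodic distribution `u` is represented by its
Fourier coefficients `u m`, that is `u = ∑ₘ u m · e^{imθ}`; it is real (takes values in `ℝᵈ`) iff
`u (-m) = conj (u m)` for all `m`. -/

/-- Fourier coefficient sequences of `ℂᵈ`-valued periodic distributions. -/
abbrev Coeffs (d : ℕ) : Type := ℤ → EuclideanSpace ℂ (Fin d)

/-- The weight `⟨m⟩ᵏ = (1 + m²)^{k/2}`, for an integer `k` of either sign. -/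
def weight (k m : ℤ) : ℝ := Real.sqrt (1 + (m : ℝ) ^ 2) ^ k

theorem weight_pos (k m : ℤ) : 0 < weight k m := by
  unfold weight; positivity

/-- The sequences `u` of Fourier coefficients of elements of `Hᵏ(S¹, ℝᵈ)`, `k ∈ ℤ`:
`u` is real, and `∑ₘ (1 + m²)ᵏ |u m|² < ∞`. -/
def sobolevSubmodule (d : ℕ) (k : ℤ) : Submodule ℝ (Coeffs d) where
  carrier := {u | (∀ m j, u (-m) j = conj (u m j)) ∧ Memℓp (fun m => weight k m • u m) 2}
  add_mem' := by
    rintro u v ⟨hu, hu'⟩ ⟨hv, hv'⟩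
    refine ⟨fun m j => by simp [hu m j, hv m j], ?_⟩
    convert hu'.add hv' using 1
    funext m
    simp
  zero_mem' := by
    refine ⟨fun m j => by simp, ?_⟩
    convert (zero_memℓp : Memℓp (0 : ℤ → EuclideanSpace ℂ (Fin d)) 2) using 1
    funext m
    simp
  smul_mem' := by
    rintro r u ⟨hu, hu'⟩
    refine ⟨fun m j => by simp [hu m j], ?_⟩
    convert hu'.const_smul r using 1
    funext m
    simp [smul_comm r]

/-- The Sobolev space `Hᵏ(S¹, ℝᵈ)` of integer order `k`. -/
def H (d : ℕ) (k : ℤ) : Type := sobolevSubmodule d k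

namespace H

variable {d : ℕ} {k : ℤ}

instance : AddCommGroup (H d k) := inferInstanceAs (AddCommGroup (sobolevSubmodule d k))

instance : Module ℝ (H d k) := inferInstanceAs (Module ℝ (sobolevSubmodule d k))

/-- The Fourier coefficients of an element of `Hᵏ(S¹, ℝᵈ)`. -/
def coeff (u : H d k) : Coeffs d := u.1

/-- The map `u ↦ (⟨m⟩ᵏ u m)ₘ` into `ℓ²`; the norm of `Hᵏ` is pulled back along it. -/
def toL2 (d : ℕ) (k : ℤ) : H d k →ₗ[ℝ] lp (fun _ : ℤ => EuclideanSpace ℂ (Fin d)) 2 where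
  toFun u := ⟨fun m => weight k m • u.coeff m, u.2.2⟩
  map_add' u v := by
    ext1
    funext m
    exact smul_add (weight k m) (u.coeff m) (v.coeff m)
  map_smul' r u := by
    ext1
    funext m
    exact smul_comm (weight k m) r (u.coeff m)

theorem toL2_injective (d : ℕ) (k : ℤ) : Function.Injective (toL2 d k) := by
  intro u v huv
  apply Subtype.ext
  funext m
  have h := congrFun (congrArg Subtype.val huv) m
  exact smul_right_injective _ (weight_pos k m).ne' h

instance : NormedAddCommGroup (H d k) :=
  NormedAddCommGroup.induced (H d k) _ (toL2 d k) (toL2_injective d k)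

instance : NormedSpace ℝ (H d k) := NormedSpace.induced ℝ (H d k) _ (toL2 d k)

theorem norm_sq_eq (u : H d k) :
    ‖u‖ ^ 2 = ∑' m : ℤ, (1 + (m : ℝ) ^ 2) ^ k * ‖u.coeff m‖ ^ 2 := by
  have h := lp.norm_rpow_eq_tsum (p := 2) (by norm_num) (toL2 d k u)
  have h' : ‖u‖ ^ 2 = ∑' m : ℤ, ‖toL2 d k u m‖ ^ 2 := by
    have e : ‖u‖ = ‖toL2 d k u‖ := rfl
    rw [e]
    simpa using h
  rw [h']
  refine tsum_congr fun m => ?_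
  have e : toL2 d k u m = weight k m • u.coeff m := rfl
  rw [e, norm_smul, mul_pow, Real.norm_of_nonneg (weight_pos k m).le, weight, ← zpow_natCast,
    ← zpow_mul, mul_comm k, zpow_mul, zpow_natCast, Real.sq_sqrt (by positivity)]

end H

instance instFactTwoPiPos : Fact (0 < 2 * Real.pi) := ⟨Real.two_pi_pos⟩

/-- The derivative `∂_θ` of distributions: `(∂_θ u)(m) = i m u(m)`. -/
def dTheta {d : ℕ} (u : Coeffs d) : Coeffs d := fun m => (Complex.I * (m : ℂ)) • u m

/-- The product `f u` of a real function `f` on the circle with a distribution `u`: the Fourier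
coefficients of `f` and `u` are convolved.  The series converges absolutely whenever
`f ∈ Hˢ` and `u ∈ Hᵏ` with `|k| ≤ s`. -/
def mulFun {d : ℕ} (f : AddCircle (2 * Real.pi) → ℝ) (u : Coeffs d) : Coeffs d :=
  fun m => ∑' l : ℤ, fourierCoeff (fun θ => (f θ : ℂ)) (m - l) • u l

/-- The value `u(θ) = ∑ₘ u(m) e^{imθ} ∈ ℝᵈ` of a real distribution with absolutely
summable Fourier coefficients, i.e. its continuous representative. -/
def eval {d : ℕ} (u : Coeffs d) (θ : AddCircle (2 * Real.pi)) : EuclideanSpace ℝ (Fin d) :=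
  WithLp.toLp 2 fun j => (∑' m : ℤ, fourier m θ * u m j).re

/-- The speed `|c'| : S¹ → ℝ` of a plane curve `c` of class `Hᵖ`, `p ≥ 2`. -/
def speed {p : ℤ} (c : H 2 p) (θ : AddCircle (2 * Real.pi)) : ℝ := ‖eval (dTheta c.coeff) θ‖

/-- The space `Immᵖ(S¹, ℝ²)` of Sobolev immersions, `p ≥ 2`: the curves `c ∈ Hᵖ(S¹, ℝ²)` with
`c'(θ) ≠ 0` for every `θ`. -/
def Imm (p : ℤ) : Set (H 2 p) := {c | ∀ θ, eval (dTheta c.coeff) θ ≠ 0}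

/-- The arc length derivative `D_s = (1 / |c'|) ∘ ∂_θ` along `c`. -/
def Ds {p : ℤ} {d : ℕ} (c : H 2 p) (u : Coeffs d) : Coeffs d :=
  mulFun (fun θ => (speed c θ)⁻¹) (dTheta u)

/-- The transpose `D_s* = -∂_θ ∘ (1 / |c'|)` of the arc length derivative with respect to the
`L²(dθ)` pairing. -/
def DsStar {p : ℤ} {d : ℕ} (c : H 2 p) (u : Coeffs d) : Coeffs d :=
  -dTheta (mulFun (fun θ => (speed c θ)⁻¹) u)

/-- The operator `L̄_c = ∑_{k=0}^n a_k (D_s^k)* ∘ |c'| ∘ D_s^k` of the metric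
`G_c(h, m) = ∫ ∑_{k=0}^n a_k ⟨D_s^k h, D_s^k m⟩ ds`, determined by `⟨L̄_c h, m⟩ = G_c(h, m)`. -/
def Lbar {p : ℤ} {d : ℕ} (n : ℕ) (a : ℕ → ℝ) (c : H 2 p) (h : Coeffs d) : Coeffs d :=
  ∑ k ∈ Finset.range (n + 1), a k • (DsStar c)^[k] (mulFun (speed c) ((Ds c)^[k] h))

end SobolevCurves

end

noncomputable section

namespace SobolevCurves

open MeasureTheory AddCircle Filter Topology

open scoped ENNReal NNReal

/-! ### Weights -/

/-! Everything happens on the Fourier side, where `Hᵏ` is a weighted `ℓ²` space and multiplication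
by a function is convolution. The basic estimate is that `Hˢ · Hᵏ ⊂ Hᵏ` boundedly whenever `1 ≤ s`
and `|k| ≤ s` (`weightedSq_conv_le`). It is used with `s = p - 1`, the regularity of `|c'|` and
`1/|c'|`.

These two functions must lie in `Hᵖ⁻¹` and depend smoothly on `c`. Since `|c'|²` is quadratic in
`c`, it suffices to treat `q ↦ q^{-1/2}` on positive functions in the Banach algebra `Hˢ`. There the
norms of powers of `r` grow no faster than powers of any number above the supremum of `|r|`
(`exists_sqNorm_npow_le`), so the binomial series converges and `q^{-1/2}` exists
(`exists_inv_sqrt`). Smoothness comes from the inverse function theorem for squaring near `1`,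
together with smooth inversion of operators (`contDiffOn_invSqrt`). Hence `L̄_c` is a smooth family
of bounded operators `Hᵏ → Hᵏ⁻²ⁿ` for `n ≤ k ≤ p` (`IsSmoothFamily.Lbar`).

Bijectivity is first shown on the energy space `Hⁿ → H⁻ⁿ`. There `⟨L̄_c h, h⟩ = ∑ a_j ‖√|c'| D_sʲ
h‖²`, and the terms `j = 0` and `j = n` alone control the `Hⁿ` norm through a Poincaré inequality
(`exists_coercive`), so Lax-Milgram applies. The solution is then lifted to `Hᵖ` by elliptic
regularity, one derivative at a time: the terms of order below `n` are already smoother, and the top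
term is undone layer by layer (`sqNorm_ne_top_of_Lbar`, `bijective_Lbar`). The open mapping theorem
bounds the inverse, and smoothness of inversion on invertible operators makes it smooth in `c`. -/

theorem weight_neg_right (k m : ℤ) : weight k (-m) = weight k m := by
  simp [weight]

theorem one_le_weight_one (m : ℤ) : 1 ≤ weight 1 m := by
  simp only [weight, zpow_one]
  exact Real.one_le_sqrt.2 (by nlinarith [sq_nonneg (m : ℝ)])

theorem weight_eq_zpow (k m : ℤ) : weight k m = weight 1 m ^ k := by
  simp [weight]

theorem weight_add (k l m : ℤ) : weight (k + l) m = weight k m * weight l m := by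
  rw [weight_eq_zpow, weight_eq_zpow k, weight_eq_zpow l, zpow_add₀]
  exact (weight_pos 1 m).ne'

@[simp] theorem weight_zero_left (m : ℤ) : weight 0 m = 1 := by simp [weight]

@[simp] theorem weight_zero_right (k : ℤ) : weight k 0 = 1 := by simp [weight]

theorem weight_mono {k l : ℤ} (h : k ≤ l) (m : ℤ) : weight k m ≤ weight l m := by
  rw [weight_eq_zpow k, weight_eq_zpow l]
  exact zpow_le_zpow_right₀ (one_le_weight_one m) h

theorem weight_two (m : ℤ) : weight 2 m = 1 + (m : ℝ) ^ 2 := by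
  rw [weight, zpow_ofNat, Real.sq_sqrt (by positivity)]

theorem weight_one_sq (m : ℤ) : weight 1 m ^ 2 = 1 + (m : ℝ) ^ 2 := by
  rw [← weight_two, weight_eq_zpow 2]; rfl

theorem abs_le_weight_one (m : ℤ) : |(m : ℝ)| ≤ weight 1 m :=
  abs_le_of_sq_le_sq' (by rw [weight_one_sq]; linarith) (weight_pos 1 m).le |> abs_le.2

theorem weight_one_add_le (l m : ℤ) : weight 1 (l + m) ≤ weight 1 l + weight 1 m := by
  have hl := weight_pos 1 l
  have hm := weight_pos 1 m
  refine (sq_le_sq₀ (weight_pos 1 _).le (by positivity)).1 ?_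
  rw [add_sq, weight_one_sq, weight_one_sq, weight_one_sq]
  have h := mul_le_mul (abs_le_weight_one l) (abs_le_weight_one m) (abs_nonneg _) hl.le
  rw [← abs_mul] at h
  have := le_abs_self ((l : ℝ) * m)
  push_cast
  nlinarith

/-- One factor `x` is bounded exactly by `y + z = y z (y⁻¹ + z⁻¹)`, which produces the decaying
factor. The remaining `j - 1` factors are bounded crudely by `2 y z`. -/
theorem pow_le_mul_of_le_add {x y z : ℝ} (hx : 1 ≤ x) (hy : 1 ≤ y) (hz : 1 ≤ z) (h : x ≤ y + z)
    {s j : ℕ} (hj : 1 ≤ j) (hjs : j ≤ s) :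
    x ^ j ≤ 2 ^ s * y ^ j * z ^ s * (y⁻¹ + z⁻¹) := by
  obtain ⟨i, rfl⟩ : ∃ i, j = i + 1 := ⟨j - 1, by omega⟩
  have h1 : x ≤ y * z * (y⁻¹ + z⁻¹) := by
    have : y * z * (y⁻¹ + z⁻¹) = y + z := by field_simp; ring
    rwa [this]
  have h2 : x ≤ 2 * (y * z) := by nlinarith
  have h3 : z ^ (i + 1) ≤ z ^ s := pow_le_pow_right₀ hz hjs
  have h4 : (2 : ℝ) ^ i ≤ 2 ^ s := pow_le_pow_right₀ (by norm_num) (by omega)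
  calc x ^ (i + 1) = x ^ i * x := pow_succ _ _
    _ ≤ (2 * (y * z)) ^ i * (y * z * (y⁻¹ + z⁻¹)) := by gcongr
    _ = 2 ^ i * y ^ (i + 1) * z ^ (i + 1) * (y⁻¹ + z⁻¹) := by rw [mul_pow, mul_pow]; ring
    _ ≤ _ := by gcongr

/-- The weight inequality behind the boundedness of multiplication `Hˢ × Hᵏ → Hᵏ`. -/
theorem weight_le_mul {s k : ℤ} (hs : 1 ≤ s) (hk : |k| ≤ s) (m l : ℤ) :
    weight k m ≤ 2 ^ s.toNat * (weight s (m - l) * weight k l *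
      (weight (-1) m + weight (-1) l + weight (-1) (m - l))) := by
  obtain ⟨s, rfl⟩ := Int.eq_ofNat_of_zero_le (by omega : 0 ≤ s)
  rw [Int.toNat_natCast]
  have hx := one_le_weight_one m
  have hy := one_le_weight_one l
  have hz := one_le_weight_one (m - l)
  have hxy : weight 1 m ≤ weight 1 l + weight 1 (m - l) := by
    simpa using weight_one_add_le l (m - l)
  have hyx : weight 1 l ≤ weight 1 m + weight 1 (m - l) := by
    have := weight_one_add_le m (-(m - l))
    rw [weight_neg_right] at this
    simpa using this
  rw [weight_eq_zpow k, weight_eq_zpow k, weight_eq_zpow s, weight_eq_zpow (-1),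
    weight_eq_zpow (-1), weight_eq_zpow (-1)]
  generalize weight 1 m = x at *
  generalize weight 1 l = y at *
  generalize weight 1 (m - l) = z at *
  have h2 : (1 : ℝ) ≤ 2 ^ s := one_le_pow₀ (by norm_num)
  simp only [zpow_neg, zpow_one, zpow_natCast]
  have hx0 : 0 < x := by linarith
  have hy0 : 0 < y := by linarith
  have hz0 : 0 < z := by linarith
  rcases lt_trichotomy k 0 with h | rfl | h
  -- For negative `k` the roles of `m` and `l` are exchanged: `⟨l⟩ ≤ ⟨m⟩ + ⟨m - l⟩` is raised to the
  -- power `|k|` and then inverted.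
  · obtain ⟨j, rfl⟩ : ∃ j : ℕ, k = -j := ⟨k.natAbs, by omega⟩
    have hj : j ≤ s := by rw [abs_neg, Nat.abs_cast] at hk; exact_mod_cast hk
    have h := pow_le_mul_of_le_add hy hx hz hyx (by omega : 1 ≤ j) hj
    simp only [zpow_neg, zpow_natCast]
    have hp : 0 < y ^ j := by positivity
    rw [inv_le_iff_one_le_mul₀' (by positivity)]
    calc 1 = y ^ j * (y ^ j)⁻¹ := by field_simp
      _ ≤ (2 ^ s * x ^ j * z ^ s * (x⁻¹ + z⁻¹)) * (y ^ j)⁻¹ := by gcongr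
      _ ≤ (2 ^ s * x ^ j * z ^ s * (x⁻¹ + y⁻¹ + z⁻¹)) * (y ^ j)⁻¹ := by
          gcongr; simp [hy0.le]
      _ = _ := by ring
  · simp only [zpow_zero, mul_one]
    have : 1 ≤ z ^ s * z⁻¹ := by
      obtain ⟨i, rfl⟩ : ∃ i, s = i + 1 := ⟨s - 1, by omega⟩
      rw [pow_succ, mul_inv_cancel_right₀ hz0.ne']
      exact one_le_pow₀ hz
    calc (1 : ℝ) ≤ 1 * (z ^ s * z⁻¹) := by simpa using this
      _ ≤ 2 ^ s * (z ^ s * (x⁻¹ + y⁻¹ + z⁻¹)) := by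
          gcongr
          have := inv_pos.2 hx0
          have := inv_pos.2 hy0
          linarith
  · obtain ⟨j, rfl⟩ := Int.eq_ofNat_of_zero_le h.le
    have hj : j ≤ s := by rw [Nat.abs_cast] at hk; exact_mod_cast hk
    have h := pow_le_mul_of_le_add hx hy hz hxy (by omega : 1 ≤ j) hj
    simp only [zpow_natCast]
    calc x ^ j ≤ 2 ^ s * y ^ j * z ^ s * (y⁻¹ + z⁻¹) := h
      _ ≤ 2 ^ s * y ^ j * z ^ s * (x⁻¹ + y⁻¹ + z⁻¹) := by
        gcongr
        have := inv_pos.2 hx0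
        linarith
      _ = _ := by ring

/-- The weight as an extended nonnegative real. -/
def eweight (k m : ℤ) : ℝ≥0∞ := ENNReal.ofReal (weight k m)

theorem eweight_ne_zero (k m : ℤ) : eweight k m ≠ 0 := by
  simp [eweight, weight_pos]

@[simp] theorem eweight_neg_right (k m : ℤ) : eweight k (-m) = eweight k m := by
  simp [eweight, weight_neg_right]

theorem eweight_add (k l m : ℤ) : eweight (k + l) m = eweight k m * eweight l m := by
  rw [eweight, weight_add, ENNReal.ofReal_mul (weight_pos _ _).le, eweight, eweight]

@[simp] theorem eweight_zero_left (m : ℤ) : eweight 0 m = 1 := by simp [eweight]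

@[simp] theorem eweight_zero_right (k : ℤ) : eweight k 0 = 1 := by simp [eweight]

theorem eweight_mono {k l : ℤ} (h : k ≤ l) (m : ℤ) : eweight k m ≤ eweight l m :=
  ENNReal.ofReal_le_ofReal (weight_mono h m)

theorem eweight_le_mul {s k : ℤ} (hs : 1 ≤ s) (hk : |k| ≤ s) (m l : ℤ) :
    eweight k m ≤ 2 ^ s.toNat * (eweight s (m - l) * eweight k l *
      (eweight (-1) m + eweight (-1) l + eweight (-1) (m - l))) := by
  have h := ENNReal.ofReal_le_ofReal (weight_le_mul hs hk m l)
  have h1 := weight_pos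
  rw [ENNReal.ofReal_mul (by positivity), ENNReal.ofReal_mul (mul_pos (h1 _ _) (h1 _ _)).le,
    ENNReal.ofReal_mul (h1 _ _).le, ENNReal.ofReal_add (add_pos (h1 _ _) (h1 _ _)).le (h1 _ _).le,
    ENNReal.ofReal_add (h1 _ _).le (h1 _ _).le, ENNReal.ofReal_pow (by norm_num)] at h
  simpa [eweight] using h

theorem tsum_eweight_neg_one_sq_ne_top : ∑' m : ℤ, eweight (-1) m ^ 2 ≠ ⊤ := by
  have h : ∀ m : ℤ, eweight (-1) m ^ 2 = ENNReal.ofReal ((1 + (m : ℝ) ^ 2)⁻¹) := by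
    intro m
    rw [eweight, ← ENNReal.ofReal_pow (weight_pos _ _).le, weight_eq_zpow, zpow_neg, zpow_one,
      inv_pow, weight_one_sq]
  simp_rw [h]
  refine Summable.tsum_ofReal_ne_top ?_
  have hs : Summable fun m : ℤ => 1 / (m : ℝ) ^ 2 := Real.summable_one_div_int_pow.2 (by norm_num)
  -- Division by zero makes `1 / m ^ 2` vanish at `m = 0`, so a unit mass there restores the
  -- domination.
  have hs' := hs.add (hasSum_ite_eq (0 : ℤ) (1 : ℝ)).summable
  refine Summable.of_nonneg_of_le (fun m => by positivity) (fun m => ?_) hs'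
  by_cases hm : m = 0
  · simp [hm]
  · have : (0 : ℝ) < (m : ℝ) ^ 2 := by positivity
    simp only [hm, if_false, add_zero, one_div]
    gcongr
    linarith

/-! ### Sums in `ℝ≥0∞` -/

/-- Cauchy-Schwarz. In `ℝ≥0∞` it needs no summability hypotheses, so convergence can be deduced from
finiteness of the right-hand side. -/
theorem sq_tsum_mul_le {ι : Type*} (f g : ι → ℝ≥0∞) :
    (∑' i, f i * g i) ^ 2 ≤ (∑' i, f i ^ 2) * ∑' i, g i ^ 2 := by
  have key : ∀ s : Finset ι, ∑ i ∈ s, f i * g i ≤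
      ((∑' i, f i ^ 2) * ∑' i, g i ^ 2) ^ (1 / 2 : ℝ) := by
    intro s
    refine (ENNReal.inner_le_Lp_mul_Lq s f g Real.HolderConjugate.two_two).trans ?_
    rw [ENNReal.mul_rpow_of_nonneg _ _ (by norm_num)]
    simp only [ENNReal.rpow_two]
    gcongr <;> exact ENNReal.sum_le_tsum s
  have h : ∑' i, f i * g i ≤ ((∑' i, f i ^ 2) * ∑' i, g i ^ 2) ^ (1 / 2 : ℝ) := by
    rw [ENNReal.tsum_eq_iSup_sum]
    exact iSup_le key
  calc (∑' i, f i * g i) ^ 2 ≤ (((∑' i, f i ^ 2) * ∑' i, g i ^ 2) ^ (1 / 2 : ℝ)) ^ 2 := by gcongr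
    _ = _ := by rw [← ENNReal.rpow_two, ← ENNReal.rpow_mul]; norm_num

theorem add_sq_le_two_mul (x y : ℝ≥0∞) : (x + y) ^ 2 ≤ 2 * (x ^ 2 + y ^ 2) := by
  have := ENNReal.rpow_add_le_mul_rpow_add_rpow x y (p := 2) (by norm_num)
  norm_num at this
  exact this

theorem tsum_sub_right_int (f : ℤ → ℝ≥0∞) (l : ℤ) : ∑' m, f (m - l) = ∑' m, f m :=
  (Equiv.subRight l).tsum_eq f

theorem tsum_sub_left_int (f : ℤ → ℝ≥0∞) (m : ℤ) : ∑' l, f (m - l) = ∑' l, f l :=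
  (Equiv.subLeft m).tsum_eq f

theorem tsum_conv (f g : ℤ → ℝ≥0∞) :
    ∑' m, ∑' l, f (m - l) * g l = (∑' m, f m) * ∑' m, g m := by
  rw [ENNReal.tsum_comm]
  simp_rw [ENNReal.tsum_mul_right, tsum_sub_right_int, ENNReal.tsum_mul_left]

/-- A trilinear convolution estimate on `ℓ²`. -/
theorem tsum_trilinear_le (A U σ : ℤ → ℝ≥0∞) :
    ∑' m, (∑' l, A (m - l) * U l * (σ m + σ l + σ (m - l))) ^ 2 ≤
      12 * ((∑' m, σ m ^ 2) * (∑' m, A m ^ 2) * ∑' m, U m ^ 2) := by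
  set S := ∑' m, σ m ^ 2
  set a := ∑' m, A m ^ 2
  set u := ∑' m, U m ^ 2
  have hB : ∑' m, ∑' l, (A (m - l) * U l) ^ 2 = a * u := by
    simp_rw [mul_pow]
    exact tsum_conv (fun m => A m ^ 2) fun m => U m ^ 2
  have h1 : ∀ m, (∑' l, A (m - l) * U l) ^ 2 ≤ a * u := fun m => by
    refine (sq_tsum_mul_le _ _).trans ?_
    rw [tsum_sub_left_int (fun m => A m ^ 2)]
  have key : ∀ m, (∑' l, A (m - l) * U l * (σ m + σ l + σ (m - l))) ^ 2 ≤
      4 * (σ m ^ 2 * (a * u)) + 8 * (S * ∑' l, (A (m - l) * U l) ^ 2) := by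
    intro m
    have e : ∑' l, A (m - l) * U l * (σ m + σ l + σ (m - l)) =
        (σ m * ∑' l, A (m - l) * U l + ∑' l, A (m - l) * U l * σ l)
          + ∑' l, A (m - l) * U l * σ (m - l) := by
      rw [← ENNReal.tsum_mul_left, ← ENNReal.tsum_add, ← ENNReal.tsum_add]
      exact tsum_congr fun l => by ring
    have e2 : (∑' l, A (m - l) * U l * σ l) ^ 2 ≤ S * ∑' l, (A (m - l) * U l) ^ 2 := by
      rw [mul_comm S]; exact sq_tsum_mul_le _ _
    have e3 : (∑' l, A (m - l) * U l * σ (m - l)) ^ 2 ≤ S * ∑' l, (A (m - l) * U l) ^ 2 := by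
      rw [mul_comm S]
      refine (sq_tsum_mul_le _ _).trans ?_
      rw [tsum_sub_left_int (fun m => σ m ^ 2)]
    rw [e]
    set T := S * ∑' l, (A (m - l) * U l) ^ 2
    calc _ ≤ 2 * ((σ m * ∑' l, A (m - l) * U l + ∑' l, A (m - l) * U l * σ l) ^ 2
          + (∑' l, A (m - l) * U l * σ (m - l)) ^ 2) := add_sq_le_two_mul _ _
      _ ≤ 2 * (2 * ((σ m * ∑' l, A (m - l) * U l) ^ 2 + (∑' l, A (m - l) * U l * σ l) ^ 2)
          + T) := by gcongr; exact add_sq_le_two_mul _ _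
      _ ≤ 2 * (2 * (σ m ^ 2 * (a * u) + T) + T) := by
          gcongr
          rw [mul_pow]; gcongr; exact h1 m
      _ = 4 * (σ m ^ 2 * (a * u)) + 6 * T := by ring
      _ ≤ _ := by gcongr; norm_num
  calc _ ≤ ∑' m, (4 * (σ m ^ 2 * (a * u)) + 8 * (S * ∑' l, (A (m - l) * U l) ^ 2)) :=
        ENNReal.tsum_le_tsum key
    _ = 4 * (S * (a * u)) + 8 * (S * (a * u)) := by
        rw [ENNReal.tsum_add, ENNReal.tsum_mul_left, ENNReal.tsum_mul_right, ENNReal.tsum_mul_left,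
          ENNReal.tsum_mul_left, hB]
    _ = _ := by ring

/-! ### Weighted `ℓ²` norms and convolutions of sequences -/

/-- The weighted square sum `∑ₘ (⟨m⟩ᵏ Aₘ)²`. -/
def weightedSq (k : ℤ) (A : ℤ → ℝ≥0∞) : ℝ≥0∞ := ∑' m, (eweight k m * A m) ^ 2

theorem weightedSq_mono_left {k l : ℤ} (h : k ≤ l) (A : ℤ → ℝ≥0∞) :
    weightedSq k A ≤ weightedSq l A :=
  ENNReal.tsum_le_tsum fun m => by gcongr; exact eweight_mono h m

theorem weightedSq_mono_right (k : ℤ) {A B : ℤ → ℝ≥0∞} (h : ∀ m, A m ≤ B m) :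
    weightedSq k A ≤ weightedSq k B :=
  ENNReal.tsum_le_tsum fun m => by gcongr; exact h m

theorem weightedSq_apply_ne_top {k : ℤ} {A : ℤ → ℝ≥0∞} (h : weightedSq k A ≠ ⊤) (m : ℤ) :
    A m ≠ ⊤ := by
  intro hA
  refine ENNReal.ne_top_of_tsum_ne_top h m ?_
  simp [hA, eweight_ne_zero]

/-- The operator norm constant of multiplication `Hˢ × Hᵏ → Hᵏ`. -/
def mulConst (s : ℤ) : ℝ≥0∞ := (2 ^ s.toNat) ^ 2 * (12 * ∑' m : ℤ, eweight (-1) m ^ 2)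

theorem mulConst_ne_top (s : ℤ) : mulConst s ≠ ⊤ :=
  ENNReal.mul_ne_top (by finiteness)
    (ENNReal.mul_ne_top (by norm_num) tsum_eweight_neg_one_sq_ne_top)

/-- The weight inequality `eweight_le_mul` moves `⟨m⟩ᵏ` inside the convolution at the price of one
factor `⟨·⟩⁻¹` in `m`, `l` or `m - l`. That factor is square summable, so the trilinear `ℓ²`
estimate applies. -/
theorem weightedSq_conv_le {s k : ℤ} (hs : 1 ≤ s) (hk : |k| ≤ s) (A U : ℤ → ℝ≥0∞) :
    weightedSq k (fun m => ∑' l, A (m - l) * U l) ≤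
      mulConst s * weightedSq s A * weightedSq k U := by
  have h : ∀ m, eweight k m * ∑' l, A (m - l) * U l ≤ 2 ^ s.toNat *
      ∑' l, (eweight s (m - l) * A (m - l)) * (eweight k l * U l) *
        (eweight (-1) m + eweight (-1) l + eweight (-1) (m - l)) := by
    intro m
    rw [← ENNReal.tsum_mul_left, ← ENNReal.tsum_mul_left]
    refine ENNReal.tsum_le_tsum fun l => ?_
    calc _ ≤ (2 ^ s.toNat * (eweight s (m - l) * eweight k l *
          (eweight (-1) m + eweight (-1) l + eweight (-1) (m - l)))) * (A (m - l) * U l) := by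
          gcongr; exact eweight_le_mul hs hk m l
      _ = _ := by ring
  calc weightedSq k (fun m => ∑' l, A (m - l) * U l)
      ≤ ∑' m, (2 ^ s.toNat * ∑' l, (eweight s (m - l) * A (m - l)) * (eweight k l * U l) *
        (eweight (-1) m + eweight (-1) l + eweight (-1) (m - l))) ^ 2 :=
        ENNReal.tsum_le_tsum fun m => pow_le_pow_left' (h m) 2
    _ = (2 ^ s.toNat) ^ 2 * ∑' m, (∑' l, (eweight s (m - l) * A (m - l)) * (eweight k l * U l) *
        (eweight (-1) m + eweight (-1) l + eweight (-1) (m - l))) ^ 2 := by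
        simp_rw [mul_pow]; rw [ENNReal.tsum_mul_left]
    _ ≤ (2 ^ s.toNat) ^ 2 * (12 * ((∑' m : ℤ, eweight (-1) m ^ 2) * weightedSq s A
          * weightedSq k U)) := by
        gcongr
        exact tsum_trilinear_le (fun m => eweight s m * A m) (fun m => eweight k m * U m)
          (eweight (-1))
    _ = _ := by rw [mulConst]; ring

/-! ### Sobolev norms of coefficient sequences, convolution and differentiation. -/

section sequences

variable {V : Type*} [NormedAddCommGroup V]

/-- The squared `Hᵏ` norm of a sequence of Fourier coefficients, with value `⊤` if it is
infinite. -/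
def sqNorm (k : ℤ) (u : ℤ → V) : ℝ≥0∞ := weightedSq k fun m => ‖u m‖ₑ

theorem sqNorm_mono {k l : ℤ} (h : k ≤ l) (u : ℤ → V) : sqNorm k u ≤ sqNorm l u :=
  weightedSq_mono_left h _

theorem sqNorm_ne_top_mono {k l : ℤ} (h : k ≤ l) {u : ℤ → V} (hu : sqNorm l u ≠ ⊤) :
    sqNorm k u ≠ ⊤ :=
  ne_top_of_le_ne_top hu (sqNorm_mono h u)

theorem enorm_zero_sq_le_sqNorm (k : ℤ) (u : ℤ → V) : ‖u 0‖ₑ ^ 2 ≤ sqNorm k u := by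
  refine le_trans (by simp) (ENNReal.le_tsum (0 : ℤ))

theorem summable_of_tsum_enorm_ne_top {ι : Type*} [CompleteSpace V] {f : ι → V}
    (h : ∑' i, ‖f i‖ₑ ≠ ⊤) : Summable f := by
  refine Summable.of_norm ?_
  have := ENNReal.tsum_coe_ne_top_iff_summable.1 h
  exact NNReal.summable_coe.2 this

/-- Cauchy-Schwarz against the square summable weight `⟨m⟩⁻¹`. -/
theorem summable_of_sqNorm_ne_top [CompleteSpace V] {s : ℤ} (hs : 1 ≤ s) {u : ℤ → V}
    (hu : sqNorm s u ≠ ⊤) : Summable u := by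
  apply summable_of_tsum_enorm_ne_top
  have h : ∀ m, ‖u m‖ₑ = eweight (-1) m * (eweight 1 m * ‖u m‖ₑ) := fun m => by
    rw [← mul_assoc, ← eweight_add]; simp
  have h2 := sq_tsum_mul_le (eweight (-1)) fun m => eweight 1 m * ‖u m‖ₑ
  simp_rw [← h] at h2
  have h3 : (∑' m, ‖u m‖ₑ) ^ 2 ≠ ⊤ := ne_top_of_le_ne_top
    (ENNReal.mul_ne_top tsum_eweight_neg_one_sq_ne_top (sqNorm_ne_top_mono hs hu)) h2
  simpa using h3

variable [NormedSpace ℂ V]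

/-- The convolution of a scalar sequence with a vector valued one. -/
def conv (a : ℤ → ℂ) (u : ℤ → V) : ℤ → V := fun m => ∑' l, a (m - l) • u l

/-- The Fourier coefficients of the derivative. -/
def derivSeq (u : ℤ → V) : ℤ → V := fun m => (Complex.I * (m : ℂ)) • u m

/-- Summability is not required: a divergent `tsum` is `0`, which satisfies the bound trivially. -/
theorem enorm_conv_le [CompleteSpace V] (a : ℤ → ℂ) (u : ℤ → V) (m : ℤ) :
    ‖conv a u m‖ₑ ≤ ∑' l, ‖a (m - l)‖ₑ * ‖u l‖ₑ := by
  by_cases h : Summable fun l => a (m - l) • u l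
  · refine (enorm_tsum_le_tsum_enorm ).trans ?_
    simp [enorm_smul]
  · simp [conv, tsum_eq_zero_of_not_summable h]

theorem sqNorm_conv_le [CompleteSpace V] {s k : ℤ} (hs : 1 ≤ s) (hk : |k| ≤ s) (a : ℤ → ℂ)
    (u : ℤ → V) : sqNorm k (conv a u) ≤ mulConst s * sqNorm s a * sqNorm k u :=
  (weightedSq_mono_right k (enorm_conv_le a u)).trans (weightedSq_conv_le hs hk _ _)

theorem sqNorm_conv_ne_top [CompleteSpace V] {s k : ℤ} (hs : 1 ≤ s) (hk : |k| ≤ s) {a : ℤ → ℂ}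
    {u : ℤ → V} (ha : sqNorm s a ≠ ⊤) (hu : sqNorm k u ≠ ⊤) : sqNorm k (conv a u) ≠ ⊤ :=
  ne_top_of_le_ne_top (ENNReal.mul_ne_top (ENNReal.mul_ne_top (mulConst_ne_top s) ha) hu)
    (sqNorm_conv_le hs hk a u)

/-- The convolution of the absolute values has finite `Hᵏ` norm, hence every coefficient of it is
finite. This is absolute convergence. -/
theorem summable_conv [CompleteSpace V] {s k : ℤ} (hs : 1 ≤ s) (hk : |k| ≤ s) {a : ℤ → ℂ}
    {u : ℤ → V} (ha : sqNorm s a ≠ ⊤) (hu : sqNorm k u ≠ ⊤) (m : ℤ) :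
    Summable fun l => a (m - l) • u l := by
  apply summable_of_tsum_enorm_ne_top
  simp_rw [enorm_smul]
  exact weightedSq_apply_ne_top (ne_top_of_le_ne_top
    (ENNReal.mul_ne_top (ENNReal.mul_ne_top (mulConst_ne_top s) ha) hu)
    (weightedSq_conv_le hs hk (fun m => ‖a m‖ₑ) fun m => ‖u m‖ₑ)) m

theorem summable_conv_zero [CompleteSpace V] {a : ℤ → ℂ} {u : ℤ → V} (ha : sqNorm 0 a ≠ ⊤)
    (hu : sqNorm 0 u ≠ ⊤) (m : ℤ) : Summable fun l => a (m - l) • u l := by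
  apply summable_of_tsum_enorm_ne_top
  simp_rw [enorm_smul]
  have h := sq_tsum_mul_le (fun l => ‖a (m - l)‖ₑ) fun l => ‖u l‖ₑ
  rw [tsum_sub_left_int (fun l => ‖a l‖ₑ ^ 2)] at h
  have h3 : (∑' l, ‖a (m - l)‖ₑ * ‖u l‖ₑ) ^ 2 ≠ ⊤ := by
    refine ne_top_of_le_ne_top (ENNReal.mul_ne_top ?_ ?_) h
    · simpa [sqNorm, weightedSq] using ha
    · simpa [sqNorm, weightedSq] using hu
  simpa using h3

theorem weightedSq_conv_conv_ne_top {s k : ℤ} (hs : 1 ≤ s) (hk : |k| ≤ s) {A B U : ℤ → ℝ≥0∞}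
    (hA : weightedSq s A ≠ ⊤) (hB : weightedSq s B ≠ ⊤) (hU : weightedSq k U ≠ ⊤) :
    weightedSq k (fun m => ∑' l, A (m - l) * ∑' j, B (l - j) * U j) ≠ ⊤ := by
  have h1 := ne_top_of_le_ne_top
    (ENNReal.mul_ne_top (ENNReal.mul_ne_top (mulConst_ne_top s) hB) hU)
    (weightedSq_conv_le hs hk B U)
  exact ne_top_of_le_ne_top
    (ENNReal.mul_ne_top (ENNReal.mul_ne_top (mulConst_ne_top s) hA) h1)
    (weightedSq_conv_le hs hk A _)

theorem summable_conv_conv [CompleteSpace V] {s k : ℤ} (hs : 1 ≤ s) (hk : |k| ≤ s) {a b : ℤ → ℂ}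
    {u : ℤ → V} (ha : sqNorm s a ≠ ⊤) (hb : sqNorm s b ≠ ⊤) (hu : sqNorm k u ≠ ⊤) (m : ℤ) :
    Summable fun x : ℤ × ℤ => (a (m - x.1) * b (x.1 - x.2)) • u x.2 := by
  apply summable_of_tsum_enorm_ne_top
  have h := weightedSq_apply_ne_top (weightedSq_conv_conv_ne_top hs hk ha hb hu) m
  simp_rw [← ENNReal.tsum_mul_left] at h
  rw [ENNReal.tsum_prod']
  simp_rw [enorm_smul, enorm_mul, mul_assoc]
  exact h

/-- Fubini: the double series converges absolutely because two successive convolutions of the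
absolute values still have finite `Hᵏ` norm. -/
theorem conv_assoc [CompleteSpace V] {s k : ℤ} (hs : 1 ≤ s) (hk : |k| ≤ s) {a b : ℤ → ℂ}
    {u : ℤ → V} (ha : sqNorm s a ≠ ⊤) (hb : sqNorm s b ≠ ⊤) (hu : sqNorm k u ≠ ⊤) :
    conv a (conv b u) = conv (conv a b) u := by
  funext m
  have h1 : ∀ l, a (m - l) • conv b u l = ∑' j, (a (m - l) * b (l - j)) • u j := fun l => by
    rw [conv, ← (summable_conv hs hk hb hu l).tsum_const_smul]
    simp_rw [smul_smul]
  have hss : |s| ≤ s := by rw [abs_of_nonneg (by omega)]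
  have h2 : ∀ j, conv a b (m - j) • u j = ∑' l, (a (m - l) * b (l - j)) • u j := fun j => by
    rw [conv, ← (summable_conv hs hss ha hb (m - j)).tsum_smul_const,
      ← (Equiv.subRight j).tsum_eq fun l => (a (m - j - l) • b l) • u j]
    simp
  rw [conv, tsum_congr h1, conv, tsum_congr h2]
  exact (Summable.tsum_comm (f := fun l j => (a (m - l) * b (l - j)) • u j)
    (summable_conv_conv hs hk ha hb hu m)).symm

theorem conv_comm (a b : ℤ → ℂ) : conv a b = conv b a := by
  funext m
  rw [conv, ← (Equiv.subLeft m).tsum_eq]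
  simp [conv, mul_comm]

theorem conv_single_zero (u : ℤ → V) : conv (Pi.single 0 1) u = u := by
  funext m
  rw [conv, tsum_eq_single m]
  · simp
  · intro l hl
    simp [sub_eq_zero, hl.symm]

theorem conv_add_right [CompleteSpace V] {s k : ℤ} (hs : 1 ≤ s) (hk : |k| ≤ s) {a : ℤ → ℂ}
    {u v : ℤ → V} (ha : sqNorm s a ≠ ⊤) (hu : sqNorm k u ≠ ⊤) (hv : sqNorm k v ≠ ⊤) :
    conv a (u + v) = conv a u + conv a v := by
  funext m
  simp only [conv, Pi.add_apply, smul_add]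
  exact (summable_conv hs hk ha hu m).tsum_add (summable_conv hs hk ha hv m)

theorem conv_add_left [CompleteSpace V] {s k : ℤ} (hs : 1 ≤ s) (hk : |k| ≤ s) {a b : ℤ → ℂ}
    {u : ℤ → V} (ha : sqNorm s a ≠ ⊤) (hb : sqNorm s b ≠ ⊤) (hu : sqNorm k u ≠ ⊤) :
    conv (a + b) u = conv a u + conv b u := by
  funext m
  simp only [conv, Pi.add_apply, add_smul]
  exact (summable_conv hs hk ha hu m).tsum_add (summable_conv hs hk hb hu m)

theorem conv_smul_right (a : ℤ → ℂ) (r : ℝ) (u : ℤ → V) : conv a (r • u) = r • conv a u := by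
  funext m
  simp only [conv, Pi.smul_apply, smul_comm _ r]
  exact tsum_const_smul'' r

theorem conv_smul_left (r : ℝ) (a : ℤ → ℂ) (u : ℤ → V) : conv (r • a) u = r • conv a u := by
  funext m
  simp only [conv, Pi.smul_apply, smul_assoc]
  exact tsum_const_smul'' r

/-- The Leibniz rule is `m = (m - l) + l` under the sum. Square summability of both factors and of
their derivatives suffices for the splitting. -/
theorem derivSeq_conv [CompleteSpace V] {a : ℤ → ℂ} {u : ℤ → V}
    (ha : sqNorm 0 a ≠ ⊤) (ha' : sqNorm 0 (derivSeq a) ≠ ⊤) (hu : sqNorm 0 u ≠ ⊤)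
    (hu' : sqNorm 0 (derivSeq u) ≠ ⊤) :
    derivSeq (conv a u) = conv (derivSeq a) u + conv a (derivSeq u) := by
  funext m
  change (Complex.I * (m : ℂ)) • (∑' l, a (m - l) • u l) =
    (∑' l, derivSeq a (m - l) • u l) + ∑' l, a (m - l) • derivSeq u l
  rw [← (summable_conv_zero ha hu m).tsum_const_smul,
    ← (summable_conv_zero ha' hu m).tsum_add (summable_conv_zero ha hu' m)]
  refine tsum_congr fun l => ?_
  simp only [derivSeq, smul_smul, ← add_smul, smul_eq_mul]
  congr 1
  push_cast
  ring

theorem enorm_derivSeq (u : ℤ → V) (m : ℤ) :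
    ‖derivSeq u m‖ₑ = ENNReal.ofReal |(m : ℝ)| * ‖u m‖ₑ := by
  rw [derivSeq, enorm_smul, enorm_mul]
  congr 1
  rw [← ofReal_norm, ← ofReal_norm]
  simp

theorem sqNorm_derivSeq_le (k : ℤ) (u : ℤ → V) : sqNorm (k - 1) (derivSeq u) ≤ sqNorm k u := by
  refine ENNReal.tsum_le_tsum fun m => ?_
  simp only [enorm_derivSeq]
  rw [← mul_assoc]
  gcongr
  calc eweight (k - 1) m * ENNReal.ofReal |(m : ℝ)| ≤ eweight (k - 1) m * eweight 1 m := by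
        gcongr; exact ENNReal.ofReal_le_ofReal (abs_le_weight_one m)
    _ = _ := by rw [← eweight_add]; simp

/-- Off the zero mode `1 + m² ≤ 2 m²`, so `∂_θ` recovers a full order of regularity. The zero mode,
which `∂_θ` kills, is added separately. -/
theorem sqNorm_le_add_derivSeq (k : ℤ) (u : ℤ → V) :
    sqNorm k u ≤ ‖u 0‖ₑ ^ 2 + 2 * sqNorm (k - 1) (derivSeq u) := by
  have h : ∀ m, (eweight k m * ‖u m‖ₑ) ^ 2 ≤
      (if m = 0 then ‖u 0‖ₑ ^ 2 else 0) + 2 * (eweight (k - 1) m * ‖derivSeq u m‖ₑ) ^ 2 := by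
    intro m
    by_cases hm : m = 0
    · simp [hm]
    · have hw : eweight 1 m ^ 2 ≤ 2 * ENNReal.ofReal |(m : ℝ)| ^ 2 := by
        rw [eweight, ← ENNReal.ofReal_pow (weight_pos _ _).le, ← ENNReal.ofReal_pow (abs_nonneg _),
          weight_one_sq, sq_abs, ← ENNReal.ofReal_ofNat 2, ← ENNReal.ofReal_mul (by norm_num)]
        refine ENNReal.ofReal_le_ofReal ?_
        have : (1 : ℝ) ≤ (m : ℝ) ^ 2 := by
          have : (1 : ℤ) ≤ m ^ 2 := by have := sq_pos_of_ne_zero hm; omega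
          exact_mod_cast this
        linarith
      rw [enorm_derivSeq]
      simp only [hm, if_false, zero_add]
      calc (eweight k m * ‖u m‖ₑ) ^ 2 = (eweight (k - 1) m * ‖u m‖ₑ) ^ 2 * eweight 1 m ^ 2 := by
            rw [← mul_pow, mul_right_comm, ← eweight_add]; simp
        _ ≤ (eweight (k - 1) m * ‖u m‖ₑ) ^ 2 * (2 * ENNReal.ofReal |(m : ℝ)| ^ 2) := by gcongr
        _ = _ := by ring
  refine (ENNReal.tsum_le_tsum h).trans ?_
  rw [ENNReal.tsum_add, tsum_ite_eq, ENNReal.tsum_mul_left]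
  rfl

theorem sqNorm_zero_le_derivSeq (u : ℤ → V) :
    ∑' m, ‖u m‖ₑ ^ 2 ≤ ‖u 0‖ₑ ^ 2 + ∑' m, ‖derivSeq u m‖ₑ ^ 2 := by
  have h : ∀ m, ‖u m‖ₑ ^ 2 ≤ (if m = 0 then ‖u 0‖ₑ ^ 2 else 0) + ‖derivSeq u m‖ₑ ^ 2 := by
    intro m
    by_cases hm : m = 0
    · simp [hm]
    · simp only [hm, if_false, zero_add]
      rw [enorm_derivSeq]
      have h1 : (1 : ℝ≥0∞) ≤ ENNReal.ofReal |(m : ℝ)| := by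
        rw [← ENNReal.ofReal_one]
        refine ENNReal.ofReal_le_ofReal ?_
        exact_mod_cast Int.one_le_abs hm
      calc ‖u m‖ₑ ^ 2 = (1 * ‖u m‖ₑ) ^ 2 := by rw [one_mul]
        _ ≤ _ := by gcongr
  refine (ENNReal.tsum_le_tsum h).trans ?_
  rw [ENNReal.tsum_add, tsum_ite_eq]

end sequences

/-! ### The spaces `Hᵏ` -/

/-- The Fourier coefficients `u` belong to a real distribution. -/
def IsReal {d : ℕ} (u : Coeffs d) : Prop := ∀ m j, u (-m) j = conj (u m j)

theorem enorm_weight_smul {d : ℕ} (k : ℤ) (u : Coeffs d) (m : ℤ) :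
    ‖weight k m • u m‖ₑ = eweight k m * ‖u m‖ₑ := by
  rw [enorm_smul, eweight, ← ofReal_norm (weight k m), Real.norm_of_nonneg (weight_pos k m).le]

theorem memℓp_iff_sqNorm_ne_top {d : ℕ} (k : ℤ) (u : Coeffs d) :
    Memℓp (fun m => weight k m • u m) 2 ↔ sqNorm k u ≠ ⊤ := by
  rw [memℓp_gen_iff (by norm_num)]
  have h : sqNorm k u = ∑' m, ((‖weight k m • u m‖₊ ^ 2 : NNReal) : ℝ≥0∞) := by
    refine tsum_congr fun m => ?_
    rw [← enorm_weight_smul]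
    simp [enorm_eq_nnnorm]
  rw [h, ENNReal.tsum_coe_ne_top_iff_summable, ← NNReal.summable_coe]
  simp

namespace H

variable {d : ℕ} {k : ℤ}

/-- The element of `Hᵏ` with given Fourier coefficients. -/
def ofCoeff (u : Coeffs d) (hr : IsReal u) (h : sqNorm k u ≠ ⊤) : H d k :=
  ⟨u, hr, (memℓp_iff_sqNorm_ne_top k u).2 h⟩

@[simp] theorem coeff_ofCoeff (u : Coeffs d) (hr : IsReal u) (h : sqNorm k u ≠ ⊤) :
    (ofCoeff u hr h).coeff = u := rfl

theorem isReal (u : H d k) : IsReal u.coeff := u.2.1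

theorem sqNorm_ne_top (u : H d k) : sqNorm k u.coeff ≠ ⊤ :=
  (memℓp_iff_sqNorm_ne_top k _).1 u.2.2

theorem coeff_injective : Function.Injective (coeff : H d k → Coeffs d) := Subtype.val_injective
@[simp] theorem coeff_smul (r : ℝ) (u : H d k) : (r • u).coeff = r • u.coeff := rfl
@[simp] theorem coeff_neg (u : H d k) : (-u).coeff = -u.coeff := rfl

/-- The Fourier coefficients as a linear map. -/
def coeffₗ (d : ℕ) (k : ℤ) : H d k →ₗ[ℝ] Coeffs d where
  toFun := coeff
  map_add' _ _ := rfl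
  map_smul' _ _ := rfl

@[simp] theorem coeff_sum {ι : Type*} (s : Finset ι) (f : ι → H d k) :
    (∑ i ∈ s, f i).coeff = ∑ i ∈ s, (f i).coeff :=
  map_sum (coeffₗ d k) f s

theorem enorm_sq (u : H d k) : ‖u‖ₑ ^ 2 = sqNorm k u.coeff := by
  have h := lp.norm_rpow_eq_tsum (p := 2) (by norm_num) (toL2 d k u)
  have h' : ‖u‖ ^ 2 = ∑' m : ℤ, ‖weight k m • u.coeff m‖ ^ 2 := by
    simp only [ENNReal.toReal_ofNat, Real.rpow_ofNat] at h
    exact h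
  have hs : Summable fun m => ‖weight k m • u.coeff m‖ ^ 2 := by
    have h2 := (memℓp_gen_iff (by norm_num)).1 u.2.2
    simp only [ENNReal.toReal_ofNat, Real.rpow_ofNat] at h2
    exact h2
  rw [← ofReal_norm, ← ENNReal.ofReal_pow (norm_nonneg _), h',
    ENNReal.ofReal_tsum_of_nonneg (fun m => by positivity) hs]
  refine tsum_congr fun m => ?_
  rw [ENNReal.ofReal_pow (norm_nonneg _), ofReal_norm, enorm_weight_smul]

/-- `toL2` as a linear isometry. -/
def toL2Isometry (d : ℕ) (k : ℤ) :
    H d k →ₗᵢ[ℝ] lp (fun _ : ℤ => EuclideanSpace ℂ (Fin d)) 2 where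
  toLinearMap := toL2 d k
  norm_map' _ := rfl

theorem continuous_lp_apply (m : ℤ) :
    Continuous fun x : lp (fun _ : ℤ => EuclideanSpace ℂ (Fin d)) 2 => x m :=
  (continuous_apply (A := fun _ : ℤ => EuclideanSpace ℂ (Fin d)) m).comp
    lp.uniformContinuous_coe.continuous

/-- The weights are nonzero and even, so only the reality condition remains. It is closed, and this
gives completeness of `Hᵏ`. -/
theorem range_toL2 : Set.range (toL2 d k) =
    {x | ∀ m j, x (-m) j = conj (x m j)} := by
  ext x
  constructor
  · rintro ⟨u, rfl⟩ m j
    change (weight k (-m) • u.coeff (-m)) j = conj ((weight k m • u.coeff m) j)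
    simp [u.isReal m j, weight_neg_right]
  · intro hx
    refine ⟨⟨fun m => (weight k m)⁻¹ • x m, fun m j => ?_, ?_⟩, ?_⟩
    · simp [hx m j, weight_neg_right]
    · convert lp.memℓp x using 1
      funext m
      exact smul_inv_smul₀ (weight_pos k m).ne' _
    · ext1
      funext m
      exact smul_inv_smul₀ (weight_pos k m).ne' _

instance : CompleteSpace (H d k) := by
  have h : IsClosed (Set.range (toL2 d k)) := by
    rw [range_toL2]
    simp only [Set.ofPred_forall]
    refine isClosed_iInter fun m => isClosed_iInter fun j => ?_
    have hc : ∀ m, Continuous fun x : lp (fun _ : ℤ => EuclideanSpace ℂ (Fin d)) 2 => x m j :=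
      fun m => (EuclideanSpace.proj (𝕜 := ℂ) j).continuous.comp
        (continuous_lp_apply m)
    exact isClosed_eq (hc _) (Complex.continuous_conj.comp (hc _))
  have hi : IsUniformInducing (toL2 d k) := (toL2Isometry d k).isometry.isUniformInducing
  exact (completeSpace_iff_isComplete_range hi).2 h.isComplete

theorem norm_le_of_sqNorm_le {C : ℝ≥0∞} (hC : C ≠ ⊤) {x : H d k} {r : ℝ} (hr : 0 ≤ r)
    (h : sqNorm k x.coeff ≤ C * ENNReal.ofReal r ^ 2) : ‖x‖ ≤ √C.toReal * r := by
  rw [← enorm_sq, ← ENNReal.ofReal_toReal hC, ← ofReal_norm, ← ENNReal.ofReal_pow (norm_nonneg _),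
    ← ENNReal.ofReal_pow hr, ← ENNReal.ofReal_mul ENNReal.toReal_nonneg,
    ENNReal.ofReal_le_ofReal_iff (by positivity)] at h
  refine (sq_le_sq₀ (norm_nonneg _) (by positivity)).1 ?_
  rwa [mul_pow, Real.sq_sqrt ENNReal.toReal_nonneg]

theorem sqNorm_coeff_eq_ofReal (u : H d k) : sqNorm k u.coeff = ENNReal.ofReal ‖u‖ ^ 2 := by
  rw [← enorm_sq, ofReal_norm]

/-- A bounded operator between Sobolev spaces from an operator on Fourier coefficients. -/
def ofOperator {d' : ℕ} {k' : ℤ} (T : Coeffs d → Coeffs d') (C : ℝ≥0∞) (hC : C ≠ ⊤)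
    (hr : ∀ u : H d k, IsReal (T u.coeff))
    (hT : ∀ u : H d k, sqNorm k' (T u.coeff) ≤ C * sqNorm k u.coeff)
    (hadd : ∀ u v : H d k, T (u.coeff + v.coeff) = T u.coeff + T v.coeff)
    (hsmul : ∀ (r : ℝ) (u : H d k), T (r • u.coeff) = r • T u.coeff) : H d k →L[ℝ] H d' k' :=
  LinearMap.mkContinuous
    { toFun := fun u => ofCoeff (T u.coeff) (hr u)
        (ne_top_of_le_ne_top (ENNReal.mul_ne_top hC u.sqNorm_ne_top) (hT u))
      map_add' := fun u v => coeff_injective (hadd u v)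
      map_smul' := fun r u => coeff_injective (hsmul r u) }
    (√C.toReal) fun u => norm_le_of_sqNorm_le hC (norm_nonneg _) <| by
      rw [← sqNorm_coeff_eq_ofReal]; exact hT u

@[simp] theorem coeff_ofOperator {d' : ℕ} {k' : ℤ} (T : Coeffs d → Coeffs d') (C : ℝ≥0∞)
    (hC : C ≠ ⊤) (hr : ∀ u : H d k, IsReal (T u.coeff))
    (hT : ∀ u : H d k, sqNorm k' (T u.coeff) ≤ C * sqNorm k u.coeff)
    (hadd : ∀ u v : H d k, T (u.coeff + v.coeff) = T u.coeff + T v.coeff)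
    (hsmul : ∀ (r : ℝ) (u : H d k), T (r • u.coeff) = r • T u.coeff) (u : H d k) :
    (ofOperator T C hC hr hT hadd hsmul u).coeff = T u.coeff := rfl

/-- The inclusion `Hᵏ → Hˡ` for `l ≤ k`. -/
def incl (d : ℕ) {k l : ℤ} (h : l ≤ k) : H d k →L[ℝ] H d l :=
  ofOperator id 1 ENNReal.one_ne_top (fun u => u.isReal)
    (fun u => by rw [one_mul]; exact sqNorm_mono h u.coeff) (fun _ _ => rfl) fun _ _ => rfl

@[simp] theorem coeff_incl {k l : ℤ} (h : l ≤ k) (u : H d k) : (incl d h u).coeff = u.coeff :=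
  coeff_ofOperator id 1 _ _ _ _ _ u

theorem isReal_dTheta {u : Coeffs d} (hu : IsReal u) : IsReal (dTheta u) := fun m j => by
  simp [dTheta, hu m j]

/-- The derivative `Hᵏ → Hˡ` for `l + 1 ≤ k`. -/
def deriv (d : ℕ) {k l : ℤ} (h : l + 1 ≤ k) : H d k →L[ℝ] H d l :=
  ofOperator dTheta 1 ENNReal.one_ne_top (fun u => isReal_dTheta u.isReal)
    (fun u => by
      rw [one_mul]
      exact (sqNorm_mono (by omega) _).trans (sqNorm_derivSeq_le k u.coeff))
    (fun u v => funext fun m => smul_add _ (u.coeff m) (v.coeff m))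
    fun r u => funext fun m => smul_comm _ r (u.coeff m)

@[simp] theorem coeff_deriv {k l : ℤ} (h : l + 1 ≤ k) (u : H d k) :
    (deriv d h u).coeff = dTheta u.coeff := rfl

end H

/-- The scalar sequence of Fourier coefficients of a real function. -/
def scalarSeq (a : Coeffs 1) : ℤ → ℂ := fun m => a m 0

theorem enorm_scalarSeq (a : Coeffs 1) (m : ℤ) : ‖scalarSeq a m‖ₑ = ‖a m‖ₑ := by
  rw [← ofReal_norm, ← ofReal_norm, EuclideanSpace.norm_eq]
  simp [scalarSeq]

theorem sqNorm_scalarSeq (s : ℤ) (a : Coeffs 1) : sqNorm s (scalarSeq a) = sqNorm s a := by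
  simp [sqNorm, enorm_scalarSeq]

theorem scalarSeq_injective : Function.Injective scalarSeq := by
  intro a b h
  funext m
  ext j
  rw [Subsingleton.elim j 0]
  exact congrFun h m

/-- Fourier coefficients of a real function from a scalar sequence. -/
def ofScalarSeq (a : ℤ → ℂ) : Coeffs 1 := fun m => WithLp.toLp 2 fun _ => a m

@[simp] theorem scalarSeq_ofScalarSeq (a : ℤ → ℂ) : scalarSeq (ofScalarSeq a) = a := rfl

theorem isReal_conv {d : ℕ} {s k : ℤ} (hs : 1 ≤ s) (hk : |k| ≤ s) {a : Coeffs 1} {u : Coeffs d}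
    (ha : IsReal a) (hu : IsReal u) (ha' : sqNorm s a ≠ ⊤) (hu' : sqNorm k u ≠ ⊤) :
    IsReal (conv (scalarSeq a) u) := by
  intro m j
  have h : ∀ m, conv (scalarSeq a) u m j = ∑' l, scalarSeq a (m - l) * u l j := fun m => by
    have hsum := summable_conv hs hk ((sqNorm_scalarSeq s a).trans_ne ha') hu' m
    exact (EuclideanSpace.proj (𝕜 := ℂ) j).map_tsum hsum
  rw [h, h, Complex.conj_tsum, ← (Equiv.neg ℤ).tsum_eq]
  refine tsum_congr fun l => ?_
  have e : -m - (Equiv.neg ℤ) l = -(m - l) := by simp; ring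
  rw [e, map_mul, scalarSeq, scalarSeq, ha (m - l), Equiv.neg_apply, hu l]

theorem scalarSeq_conv {s k : ℤ} (hs : 1 ≤ s) (hk : |k| ≤ s) {a : ℤ → ℂ} {u : Coeffs 1}
    (ha : sqNorm s a ≠ ⊤) (hu : sqNorm k u ≠ ⊤) :
    scalarSeq (conv a u) = conv a (scalarSeq u) := by
  funext m
  exact (EuclideanSpace.proj (𝕜 := ℂ) 0).map_tsum (summable_conv hs hk ha hu m)

/-! ### Multiplication of Sobolev distributions by Sobolev functions. -/

namespace H

variable {d : ℕ} {s k : ℤ}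

/-- The scalar Fourier coefficients of a real function. -/
def seq (a : H 1 s) : ℤ → ℂ := scalarSeq a.coeff

theorem sqNorm_seq (a : H 1 s) : sqNorm s a.seq = sqNorm s a.coeff := sqNorm_scalarSeq s _

theorem sqNorm_seq_ne_top (a : H 1 s) : sqNorm s a.seq ≠ ⊤ :=
  (sqNorm_seq a).trans_ne a.sqNorm_ne_top

theorem seq_injective : Function.Injective (seq : H 1 s → ℤ → ℂ) :=
  scalarSeq_injective.comp coeff_injective

@[simp] theorem seq_add (a b : H 1 s) : (a + b).seq = a.seq + b.seq := rfl
@[simp] theorem seq_smul (r : ℝ) (a : H 1 s) : (r • a).seq = r • a.seq := rfl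

theorem seq_neg_right (a : H 1 s) (m : ℤ) : a.seq (-m) = conj (a.seq m) := a.isReal m 0

/-- Multiplication `Hˢ × Hᵏ → Hᵏ`, for `1 ≤ s` and `|k| ≤ s`. -/
def mul (d : ℕ) (hs : 1 ≤ s) (hk : |k| ≤ s) : H 1 s →L[ℝ] H d k →L[ℝ] H d k :=
  LinearMap.mkContinuous₂
    (LinearMap.mk₂ ℝ
      (fun (a : H 1 s) (u : H d k) => ofCoeff (conv a.seq u.coeff)
        (isReal_conv hs hk a.isReal u.isReal a.sqNorm_ne_top u.sqNorm_ne_top)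
        (sqNorm_conv_ne_top hs hk a.sqNorm_seq_ne_top u.sqNorm_ne_top))
      (fun a b u => coeff_injective <|
        conv_add_left hs hk a.sqNorm_seq_ne_top b.sqNorm_seq_ne_top u.sqNorm_ne_top)
      (fun r a u => coeff_injective <| conv_smul_left r a.seq u.coeff)
      (fun a u v => coeff_injective <|
        conv_add_right hs hk a.sqNorm_seq_ne_top u.sqNorm_ne_top v.sqNorm_ne_top)
      (fun r a u => coeff_injective <| conv_smul_right a.seq r u.coeff))
    (√(mulConst s).toReal) fun a u => by
      rw [mul_assoc]
      refine norm_le_of_sqNorm_le (mulConst_ne_top s) (by positivity) ?_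
      rw [ENNReal.ofReal_mul (norm_nonneg _), mul_pow, ← sqNorm_coeff_eq_ofReal,
        ← sqNorm_coeff_eq_ofReal, ← mul_assoc, ← sqNorm_seq]
      exact sqNorm_conv_le hs hk _ _

@[simp] theorem coeff_mul (hs : 1 ≤ s) (hk : |k| ≤ s) (a : H 1 s) (u : H d k) :
    (mul d hs hk a u).coeff = conv a.seq u.coeff := rfl

theorem seq_mul (hs : 1 ≤ s) (hk : |k| ≤ s) (a : H 1 s) (u : H 1 k) :
    (mul 1 hs hk a u).seq = conv a.seq u.seq :=
  scalarSeq_conv hs hk a.sqNorm_seq_ne_top u.sqNorm_ne_top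

/-- The `j`-th component of a vector valued distribution. -/
def component (k : ℤ) (j : Fin d) : H d k →L[ℝ] H 1 k :=
  ofOperator (fun u => ofScalarSeq fun m => u m j) 1 ENNReal.one_ne_top
    (fun u m _ => u.isReal m j)
    (fun u => by
      rw [one_mul, ← sqNorm_scalarSeq]
      refine weightedSq_mono_right k fun m => ?_
      rw [← ofReal_norm, ← ofReal_norm]
      exact ENNReal.ofReal_le_ofReal (PiLp.norm_apply_le (u.coeff m) j))
    (fun _ _ => rfl) fun _ _ => rfl

end H

/-! ### Fourier series of functions on the circle -/

/-- The circle `ℝ / 2πℤ`. -/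
abbrev Circle2π : Type := AddCircle (2 * Real.pi)

theorem sqNorm_zero_lp (x : lp (fun _ : ℤ => ℂ) 2) : sqNorm 0 (x : ℤ → ℂ) = ‖x‖ₑ ^ 2 := by
  have h := lp.norm_rpow_eq_tsum (p := 2) (by norm_num) x
  have hs := (memℓp_gen_iff (by norm_num)).1 (lp.memℓp x)
  simp only [ENNReal.toReal_ofNat, Real.rpow_ofNat] at h hs
  rw [← ofReal_norm, ← ENNReal.ofReal_pow (norm_nonneg _), h,
    ENNReal.ofReal_tsum_of_nonneg (fun m => by positivity) hs]
  refine tsum_congr fun m => ?_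
  rw [ENNReal.ofReal_pow (norm_nonneg _), ofReal_norm, eweight_zero_left, one_mul]

theorem memℓp_of_sqNorm_ne_top {u : ℤ → ℂ} (hu : sqNorm 0 u ≠ ⊤) : Memℓp u 2 := by
  rw [memℓp_gen_iff (by norm_num)]
  have h : sqNorm 0 u = ∑' m, ((‖u m‖₊ ^ 2 : NNReal) : ℝ≥0∞) := by
    refine tsum_congr fun m => ?_
    simp [enorm_eq_nnnorm]
  rw [h, ENNReal.tsum_coe_ne_top_iff_summable, ← NNReal.summable_coe] at hu
  simpa using hu

theorem summable_smul_fourier {u : ℤ → ℂ} (hu : Summable u) :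
    Summable fun m => u m • (fourier m : C(Circle2π, ℂ)) :=
  Summable.of_norm <| by simpa [norm_smul, fourier_norm] using hu.norm

/-- The continuous function with given summable Fourier coefficients. -/
def fourierSum (u : ℤ → ℂ) : C(Circle2π, ℂ) := ∑' m, u m • fourier m

theorem hasSum_fourierSum_apply {u : ℤ → ℂ} (hu : Summable u) (θ : Circle2π) :
    HasSum (fun m => u m * fourier m θ) (fourierSum u θ) :=
  (ContinuousMap.evalCLM ℂ θ).hasSum (summable_smul_fourier hu).hasSum

/-- The uniformly convergent series also converges in `L²`, where it must agree with the expansion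
of `u` in the Hilbert basis. -/
theorem fourierCoeff_fourierSum {u : ℤ → ℂ} (hu : Summable u) (hu' : sqNorm 0 u ≠ ⊤) :
    fourierCoeff (fourierSum u) = u := by
  have h1 : HasSum (fun m => u m • (fourierBasis (T := 2 * Real.pi)) m)
      (ContinuousMap.toLp (E := ℂ) 2 haarAddCircle ℂ (fourierSum u)) := by
    have := (ContinuousMap.toLp (E := ℂ) 2 (haarAddCircle (T := 2 * Real.pi)) ℂ).hasSum
      (summable_smul_fourier hu).hasSum
    simp only [map_smul] at this
    rw [coe_fourierBasis]
    exact this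
  have h2 := (fourierBasis (T := 2 * Real.pi)).hasSum_repr_symm ⟨u, memℓp_of_sqNorm_ne_top hu'⟩
  have h3 := h1.unique h2
  funext n
  rw [← fourierCoeff_toLp, ← fourierBasis_repr, h3, LinearIsometryEquiv.apply_symm_apply]

theorem memLp_mul (f : C(Circle2π, ℂ)) (g : Lp ℂ 2 (haarAddCircle (T := 2 * Real.pi))) :
    MemLp (fun θ => f θ * g θ) 2 (haarAddCircle (T := 2 * Real.pi)) := by
  refine MemLp.of_le_mul (c := ‖f‖) (Lp.memLp g)
    (f.continuous.aestronglyMeasurable.mul (Lp.memLp g).1) (ae_of_all _ fun θ => ?_)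
  rw [norm_mul]
  gcongr
  exact f.norm_coe_le_norm θ

/-- The Fourier coefficients of a product are the convolution of the Fourier coefficients. -/
theorem fourierCoeff_mul (f : C(Circle2π, ℂ)) (g : Lp ℂ 2 (haarAddCircle (T := 2 * Real.pi))) :
    fourierCoeff (fun θ => f θ * g θ) = conv (fourierCoeff f) (fourierCoeff g) := by
  funext n
  -- With `h = conj f · e_n`, the `n`-th coefficient of `f g` is `⟨h, g⟩`, and Parseval expands it
  -- into the convolution.
  set h : C(Circle2π, ℂ) := star f * fourier n
  set h' := ContinuousMap.toLp (E := ℂ) 2 (haarAddCircle (T := 2 * Real.pi)) ℂ h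
  have e1 : fourierCoeff (fun θ => f θ * g θ) n = inner ℂ h' g := by
    rw [L2.inner_def, fourierCoeff]
    refine integral_congr_ae ?_
    filter_upwards [ContinuousMap.coeFn_toLp (p := 2) (𝕜 := ℂ) haarAddCircle h] with θ hθ
    rw [hθ]
    simp only [h, ContinuousMap.mul_apply, ContinuousMap.star_apply, RCLike.inner_apply,
      map_mul, fourier_neg, smul_eq_mul]
    simp
    ring
  have e2 : ∀ l, inner ℂ h' (fourierBasis l) = fourierCoeff f (n - l) := by
    intro l
    rw [← inner_conj_symm, ← HilbertBasis.repr_apply_apply, fourierBasis_repr, fourierCoeff_toLp,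
      fourierCoeff, fourierCoeff, ← integral_conj]
    congr 1
    funext θ
    rw [neg_sub, sub_eq_add_neg, fourier_add, fourier_neg, fourier_neg]
    simp [h]
    ring
  rw [e1, ← (fourierBasis (T := 2 * Real.pi)).tsum_inner_mul_inner h' g]
  refine tsum_congr fun l => ?_
  rw [e2, ← HilbertBasis.repr_apply_apply, fourierBasis_repr, smul_eq_mul]

/-- Multiplication by a bounded function on `L²`. -/
theorem sqNorm_zero_conv_le {a u : ℤ → ℂ} (ha : Summable a) (ha' : sqNorm 0 a ≠ ⊤) {c : ℝ}
    (hc : ∀ θ, ‖fourierSum a θ‖ ≤ c) (hu : sqNorm 0 u ≠ ⊤) :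
    sqNorm 0 (conv a u) ≤ ENNReal.ofReal c ^ 2 * sqNorm 0 u := by
  have hc0 : 0 ≤ c := (norm_nonneg _).trans (hc 0)
  set x : lp (fun _ : ℤ => ℂ) 2 := ⟨u, memℓp_of_sqNorm_ne_top hu⟩
  set g := (fourierBasis (T := 2 * Real.pi)).repr.symm x
  have hg : fourierCoeff g = u := by
    funext n
    rw [← fourierBasis_repr, LinearIsometryEquiv.apply_symm_apply]
  set G := (memLp_mul (fourierSum a) g).toLp
  have hG : fourierCoeff G = conv a u := by
    rw [← fourierCoeff_fourierSum ha ha', ← hg, ← fourierCoeff_mul]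
    funext n
    rw [fourierCoeff_congr_ae (MemLp.coeFn_toLp _)]
  have hn : ‖G‖ ≤ c * ‖g‖ := by
    refine Lp.norm_le_mul_norm_of_ae_le_mul ?_
    filter_upwards [(memLp_mul (fourierSum a) g).coeFn_toLp] with θ hθ
    rw [hθ, norm_mul]
    gcongr
    exact hc θ
  have h1 : conv a u = (fourierBasis.repr G : ℤ → ℂ) := by
    rw [← hG]; funext n; rw [fourierBasis_repr]
  have h2 : u = (x : ℤ → ℂ) := rfl
  rw [h1, sqNorm_zero_lp, h2, sqNorm_zero_lp, ← mul_pow]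
  have h3 : ‖x‖ = ‖g‖ := (LinearIsometryEquiv.norm_map _ _).symm
  rw [← ofReal_norm, ← ofReal_norm, LinearIsometryEquiv.norm_map, h3, ← ENNReal.ofReal_mul hc0]
  gcongr

/-- The product of the two functions has the summable coefficients `conv a b`, so its Fourier series
converges to it at every point. -/
theorem fourierSum_conv {s : ℤ} (hs : 1 ≤ s) {a b : ℤ → ℂ} (ha : sqNorm s a ≠ ⊤)
    (hb : sqNorm s b ≠ ⊤) (θ : Circle2π) :
    fourierSum (conv a b) θ = fourierSum a θ * fourierSum b θ := by
  have hss : |s| ≤ s := by rw [abs_of_nonneg (by omega)]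
  have ha1 := summable_of_sqNorm_ne_top hs ha
  have hb1 := summable_of_sqNorm_ne_top hs hb
  have hab1 := summable_of_sqNorm_ne_top hs (sqNorm_conv_ne_top hs hss ha hb)
  have h0 : (0 : ℤ) ≤ s := by omega
  have e : fourierCoeff (fourierSum a * fourierSum b : C(Circle2π, ℂ)) = conv a b := by
    have h := fourierCoeff_mul (fourierSum a)
      (ContinuousMap.toLp (E := ℂ) 2 haarAddCircle ℂ (fourierSum b))
    rw [funext (fourierCoeff_toLp (fourierSum b)),
      fourierCoeff_fourierSum ha1 (sqNorm_ne_top_mono h0 ha),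
      fourierCoeff_fourierSum hb1 (sqNorm_ne_top_mono h0 hb)] at h
    rw [← h]
    refine fourierCoeff_congr_ae (E := ℂ) ?_
    filter_upwards [ContinuousMap.coeFn_toLp (p := 2) (𝕜 := ℂ) haarAddCircle (fourierSum b)]
      with θ hθ
    rw [hθ]; rfl
  have h1 := has_pointwise_sum_fourier_series_of_summable
    (f := (fourierSum a * fourierSum b : C(Circle2π, ℂ))) (by rw [e]; exact hab1) θ
  rw [e] at h1
  exact (hasSum_fourierSum_apply hab1 θ).unique h1

/-! ### Pointwise values of Sobolev functions. -/

namespace H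

variable {s : ℤ}

/-- The value of a real function of class `Hˢ`, `s ≥ 1`, at a point of the circle. -/
def val (a : H 1 s) (θ : Circle2π) : ℝ := eval a.coeff θ 0

theorem summable_seq (hs : 1 ≤ s) (a : H 1 s) : Summable a.seq :=
  summable_of_sqNorm_ne_top hs a.sqNorm_seq_ne_top

theorem sqNorm_zero_seq_ne_top (hs : 1 ≤ s) (a : H 1 s) : sqNorm 0 a.seq ≠ ⊤ :=
  sqNorm_ne_top_mono (by omega) a.sqNorm_seq_ne_top

/-- The reality condition makes the series equal to its conjugate after `m ↦ -m`, so taking the real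
part in `eval` loses nothing. -/
theorem ofReal_val (hs : 1 ≤ s) (a : H 1 s) (θ : Circle2π) :
    (a.val θ : ℂ) = fourierSum a.seq θ := by
  have h := hasSum_fourierSum_apply (summable_seq hs a) θ
  have hv : a.val θ = (fourierSum a.seq θ).re := by
    rw [← h.tsum_eq]
    change (∑' m : ℤ, fourier m θ * a.coeff m 0).re = _
    simp_rw [mul_comm (fourier _ θ)]
    rfl
  rw [hv]
  refine Complex.conj_eq_iff_re.1 ?_
  rw [← h.tsum_eq, Complex.conj_tsum, ← (Equiv.neg ℤ).tsum_eq]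
  refine tsum_congr fun m => ?_
  rw [map_mul, Equiv.neg_apply, seq_neg_right, Complex.conj_conj, fourier_neg, Complex.conj_conj]

theorem fourierCoeff_val (hs : 1 ≤ s) (a : H 1 s) :
    fourierCoeff (fun θ => (a.val θ : ℂ)) = a.seq := by
  simp_rw [ofReal_val hs]
  exact fourierCoeff_fourierSum (summable_seq hs a) (sqNorm_zero_seq_ne_top hs a)

theorem continuous_val (hs : 1 ≤ s) (a : H 1 s) : Continuous a.val := by
  have h : Continuous fun θ => (a.val θ : ℂ) := by
    simp_rw [ofReal_val hs]
    exact (fourierSum a.seq).continuous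
  have h' := Complex.continuous_re.comp h
  exact h'

theorem val_injective (hs : 1 ≤ s) : Function.Injective (val : H 1 s → Circle2π → ℝ) := by
  intro a b h
  apply seq_injective
  rw [← fourierCoeff_val hs, ← fourierCoeff_val hs, h]

theorem val_mul (hs : 1 ≤ s) (hss : |s| ≤ s) (a b : H 1 s) (θ : Circle2π) :
    (mul 1 hs hss a b).val θ = a.val θ * b.val θ := by
  have : ((mul 1 hs hss a b).val θ : ℂ) = a.val θ * b.val θ := by
    rw [ofReal_val hs, ofReal_val hs, ofReal_val hs, seq_mul,
      fourierSum_conv hs a.sqNorm_seq_ne_top b.sqNorm_seq_ne_top]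
  exact_mod_cast this

theorem val_add (hs : 1 ≤ s) (a b : H 1 s) (θ : Circle2π) : (a + b).val θ = a.val θ + b.val θ := by
  have : ((a + b).val θ : ℂ) = a.val θ + b.val θ := by
    simp only [ofReal_val hs]
    refine (hasSum_fourierSum_apply (summable_seq hs (a + b)) θ).unique ?_
    simpa [add_mul] using (hasSum_fourierSum_apply (summable_seq hs a) θ).add
      (hasSum_fourierSum_apply (summable_seq hs b) θ)
  exact_mod_cast this

theorem val_smul (hs : 1 ≤ s) (r : ℝ) (a : H 1 s) (θ : Circle2π) :
    (r • a).val θ = r * a.val θ := by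
  have : ((r • a).val θ : ℂ) = r * a.val θ := by
    simp only [ofReal_val hs]
    refine (hasSum_fourierSum_apply (summable_seq hs (r • a)) θ).unique ?_
    simpa [mul_assoc] using (hasSum_fourierSum_apply (summable_seq hs a) θ).mul_left (r : ℂ)
  exact_mod_cast this

/-- A constant of the Sobolev embedding `H¹ ⊂ C⁰`. -/
def embConst : ℝ := √(∑' m : ℤ, eweight (-1) m ^ 2).toReal

theorem abs_val_le (hs : 1 ≤ s) (a : H 1 s) (θ : Circle2π) : |a.val θ| ≤ embConst * ‖a‖ := by
  have h1 : ‖(a.val θ : ℂ)‖ₑ ≤ ∑' m, ‖a.seq m‖ₑ := by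
    rw [ofReal_val hs, ← (hasSum_fourierSum_apply (summable_seq hs a) θ).tsum_eq]
    refine enorm_tsum_le_tsum_enorm.trans (ENNReal.tsum_le_tsum fun m => ?_)
    rw [enorm_mul]
    have : ‖fourier m θ‖ₑ = 1 := by
      rw [← ofReal_norm, fourier_apply, Circle.norm_coe, ENNReal.ofReal_one]
    rw [this, mul_one]
  have h : ∀ m, ‖a.seq m‖ₑ = eweight (-1) m * (eweight 1 m * ‖a.seq m‖ₑ) := fun m => by
    rw [← mul_assoc, ← eweight_add]; simp
  have h2 := sq_tsum_mul_le (eweight (-1)) fun m => eweight 1 m * ‖a.seq m‖ₑ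
  simp_rw [← h] at h2
  have h3 : ‖(a.val θ : ℂ)‖ₑ ^ 2 ≤
      (∑' m : ℤ, eweight (-1) m ^ 2) * ENNReal.ofReal ‖a‖ ^ 2 := by
    rw [← sqNorm_coeff_eq_ofReal, ← sqNorm_seq]
    refine (pow_le_pow_left' h1 2).trans (h2.trans ?_)
    gcongr
    exact sqNorm_mono hs a.seq
  rw [← ENNReal.ofReal_toReal tsum_eweight_neg_one_sq_ne_top, ← ofReal_norm,
    ← ENNReal.ofReal_pow (norm_nonneg _), ← ENNReal.ofReal_pow (norm_nonneg _),
    ← ENNReal.ofReal_mul ENNReal.toReal_nonneg,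
    ENNReal.ofReal_le_ofReal_iff (by positivity)] at h3
  refine (sq_le_sq₀ (abs_nonneg _) (by unfold embConst; positivity)).1 ?_
  rw [mul_pow, embConst, Real.sq_sqrt ENNReal.toReal_nonneg]
  simpa using h3

/-- Evaluation at a point as a continuous linear functional on `Hˢ`, `s ≥ 1`. -/
def valCLM (hs : 1 ≤ s) (θ : Circle2π) : H 1 s →L[ℝ] ℝ :=
  LinearMap.mkContinuous
    { toFun := fun a => a.val θ
      map_add' := fun a b => val_add hs a b θ
      map_smul' := fun r a => val_smul hs r a θ } embConst fun a => abs_val_le hs a θ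

@[simp] theorem valCLM_apply (hs : 1 ≤ s) (θ : Circle2π) (a : H 1 s) : valCLM hs θ a = a.val θ :=
  rfl

/-- The constant function `1`. -/
def one (s : ℤ) : H 1 s :=
  ofCoeff (ofScalarSeq (Pi.single 0 1))
    (fun m j => by
      by_cases h : m = 0
      · subst h; simp [ofScalarSeq]
      · simp [ofScalarSeq, h])
    (by
      rw [← sqNorm_scalarSeq, scalarSeq_ofScalarSeq, sqNorm, weightedSq, tsum_eq_single 0]
      · simp
      · intro m hm; simp [hm])

@[simp] theorem seq_one : (one s).seq = Pi.single 0 1 := rfl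

theorem val_one (hs : 1 ≤ s) (θ : Circle2π) : (one s).val θ = 1 := by
  have : ((one s).val θ : ℂ) = 1 := by
    rw [ofReal_val hs, ← (hasSum_fourierSum_apply (summable_seq hs (one s)) θ).tsum_eq,
      tsum_eq_single 0]
    · simp
    · intro m hm; simp [hm]
  exact_mod_cast this

end H

/-! ### Powers, and the inverse square root of a positive function -/

/-- The factor `n + 1` comes from differentiating an `(n + 1)`-st power. It is absorbed by a slight
increase of the geometric rate. -/
theorem exists_mul_pow_le {ρ' ρ : ℝ≥0} (h : ρ' < ρ) :
    ∃ K : ℝ≥0, ∀ n : ℕ, (n + 1 : ℝ≥0) * ρ' ^ n ≤ K * ρ ^ (n + 1) := by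
  have hρ : 0 < ρ := pos_of_gt h
  have hr : (ρ' / ρ : ℝ≥0) < 1 := (div_lt_one hρ).2 h
  have ht := tendsto_pow_const_mul_const_pow_of_lt_one 1 (ρ' / ρ : ℝ≥0).2 hr
  obtain ⟨B, hB⟩ := ht.bddAbove_range
  have hB' : ∀ n : ℕ, (n : ℝ) ^ 1 * ((ρ' / ρ : ℝ≥0) : ℝ) ^ n ≤ B := fun n => hB ⟨n, rfl⟩
  refine ⟨(B.toNNReal + 1) / ρ, fun n => ?_⟩
  have h1 : (n + 1 : ℝ≥0) * (ρ' / ρ) ^ n ≤ B.toNNReal + 1 := by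
    rw [add_mul, one_mul]
    gcongr
    · rw [← NNReal.coe_le_coe]
      have := hB' n
      rw [pow_one] at this
      push_cast at this ⊢
      exact this.trans (Real.le_coe_toNNReal B)
    · exact pow_le_one₀ zero_le hr.le
  calc (n + 1 : ℝ≥0) * ρ' ^ n = ((n + 1 : ℝ≥0) * (ρ' / ρ) ^ n) * ρ ^ n := by
        rw [mul_assoc, ← mul_pow, div_mul_cancel₀ _ hρ.ne']
    _ ≤ (B.toNNReal + 1) * ρ ^ n := by gcongr
    _ = _ := by rw [pow_succ']; field_simp

theorem sqNorm_nsmul {V : Type*} [NormedAddCommGroup V] [NormedSpace ℂ V] (k : ℤ) (n : ℕ)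
    (u : ℤ → V) : sqNorm k (n • u) = (n : ℝ≥0∞) ^ 2 * sqNorm k u := by
  rw [sqNorm, sqNorm, weightedSq, weightedSq, ← ENNReal.tsum_mul_left]
  refine tsum_congr fun m => ?_
  have : ‖(n • u) m‖ₑ = n * ‖u m‖ₑ := by
    rw [Pi.smul_apply, ← Nat.cast_smul_eq_nsmul ℂ, enorm_smul]
    congr 1
    rw [← ofReal_norm]
    simp
  rw [this]
  ring

namespace H

variable {s : ℤ}

/-- The powers of a function in the algebra `Hˢ`. -/
def npow (hs : 1 ≤ s) (hss : |s| ≤ s) (r : H 1 s) (k : ℕ) : H 1 s :=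
  (mul 1 hs hss r)^[k] (one s)

variable (hs : 1 ≤ s) (hss : |s| ≤ s) (r : H 1 s)

theorem npow_succ (k : ℕ) : npow hs hss r (k + 1) = mul 1 hs hss r (npow hs hss r k) :=
  Function.iterate_succ_apply' _ _ _

theorem val_npow (k : ℕ) (θ : Circle2π) : (npow hs hss r k).val θ = r.val θ ^ k := by
  induction k with
  | zero => simpa [npow] using val_one hs θ
  | succ k ih => rw [npow_succ, val_mul, ih, pow_succ']

theorem sqNorm_zero_derivSeq_ne_top (a : H 1 s) (h1 : 1 ≤ s) : sqNorm 0 (derivSeq a.seq) ≠ ⊤ := by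
  refine ne_top_of_le_ne_top a.sqNorm_seq_ne_top ?_
  exact (sqNorm_mono (by omega) _).trans (sqNorm_derivSeq_le s _)

/-- The chain rule `(r^{k+1})' = (k + 1) r^k r'`, by induction from the Leibniz rule. -/
theorem derivSeq_npow_succ (k : ℕ) : derivSeq (npow hs hss r (k + 1)).seq =
    (k + 1) • conv (npow hs hss r k).seq (derivSeq r.seq) := by
  have h0 : |(0 : ℤ)| ≤ s := by simp; omega
  have hr' := sqNorm_zero_derivSeq_ne_top r hs
  have key : ∀ k, derivSeq (npow hs hss r (k + 1)).seq =
      conv (npow hs hss r k).seq (derivSeq r.seq) +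
        conv r.seq (derivSeq (npow hs hss r k).seq) := fun k => by
    rw [npow_succ, seq_mul, derivSeq_conv (sqNorm_zero_seq_ne_top hs r)
      hr' (sqNorm_zero_seq_ne_top hs _) (sqNorm_zero_derivSeq_ne_top _ hs),
      conv_comm (derivSeq r.seq)]
  induction k with
  | zero =>
    rw [key]
    have : derivSeq (npow hs hss r 0).seq = 0 := by
      funext m
      by_cases hm : m = 0
      · simp [hm, derivSeq]
      · simp [npow, derivSeq, hm]
    rw [this]
    have h2 : conv r.seq (0 : ℤ → ℂ) = 0 := by funext m; simp [conv]
    simp [h2]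
  | succ k ih =>
    rw [key, ih]
    have h3 : conv r.seq ((k + 1) • conv (npow hs hss r k).seq (derivSeq r.seq)) =
        (k + 1) • conv r.seq (conv (npow hs hss r k).seq (derivSeq r.seq)) := by
      rw [← Nat.cast_smul_eq_nsmul ℝ, ← Nat.cast_smul_eq_nsmul ℝ, conv_smul_right]
    rw [h3, conv_assoc hs h0 r.sqNorm_seq_ne_top (sqNorm_seq_ne_top _) hr', ← seq_mul hs hss,
      ← npow_succ]
    rw [add_comm, ← succ_nsmul]

/-- The spectral radius of a function in `Hˢ` is at most its supremum norm. -/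
theorem exists_sqNorm_npow_le {c : ℝ≥0} (hc : ∀ θ, |r.val θ| ≤ c) (j : ℕ) (hj : (j : ℤ) ≤ s)
    {ρ : ℝ≥0} (hρ : c < ρ) :
    ∃ C : ℝ≥0, ∀ k, sqNorm j (npow hs hss r k).seq ≤ C * ((ρ : ℝ≥0∞) ^ k) ^ 2 := by
  have hsup : ∀ k θ, ‖fourierSum (npow hs hss r k).seq θ‖ ≤ ((c ^ k : ℝ≥0) : ℝ) := by
    intro k θ
    rw [← ofReal_val hs, val_npow, Complex.norm_real, Real.norm_eq_abs, abs_pow, NNReal.coe_pow]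
    gcongr
    exact hc θ
  have hpow : ∀ k, ENNReal.ofReal ((c ^ k : ℝ≥0) : ℝ) ≤ (c : ℝ≥0∞) ^ k := by
    intro k; rw [ENNReal.ofReal_coe_nnreal, ENNReal.coe_pow]
  have hL2 : ∀ k (u : ℤ → ℂ), sqNorm 0 u ≠ ⊤ →
      sqNorm 0 (conv (npow hs hss r k).seq u) ≤ ((c : ℝ≥0∞) ^ k) ^ 2 * sqNorm 0 u := by
    intro k u hu
    refine (sqNorm_zero_conv_le (summable_seq hs _) (sqNorm_zero_seq_ne_top hs _) (hsup k)
      hu).trans ?_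
    gcongr
    exact hpow k
  have hone : sqNorm 0 (Pi.single 0 1 : ℤ → ℂ) = 1 := by
    rw [sqNorm, weightedSq, tsum_eq_single 0]
    · simp
    · intro m hm; simp [hm]
  have hbase : ∀ k, sqNorm 0 (npow hs hss r k).seq ≤ ((c : ℝ≥0∞) ^ k) ^ 2 := by
    intro k
    have := hL2 k (Pi.single 0 1) (by rw [hone]; simp)
    rwa [conv_comm, conv_single_zero, hone, mul_one] at this
  -- Each additional derivative costs a factor linear in `k`. The rate must therefore be free, so
  -- that the induction hypothesis can be used at some `ρ'` strictly between `c` and `ρ`.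
  induction j generalizing ρ with
  | zero =>
    refine ⟨1, fun k => ?_⟩
    rw [ENNReal.coe_one, one_mul]
    refine (hbase k).trans ?_
    gcongr
  | succ j ih =>
    obtain ⟨ρ', h1, h2⟩ := exists_between hρ
    obtain ⟨C, hC⟩ := ih (by push_cast at hj; omega) h1
    have hr' := sqNorm_zero_derivSeq_ne_top r hs
    have hconv : ∃ B : ℝ≥0, ∀ k, sqNorm j (conv (npow hs hss r k).seq (derivSeq r.seq)) ≤
        B * ((ρ' : ℝ≥0∞) ^ k) ^ 2 := by
      -- For `j = 0` the algebra estimate, which needs order at least `1`, is replaced by the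
      -- supremum bound on `L²`. For `j ≥ 1` it applies, because `r' ∈ Hˢ⁻¹ ⊂ Hʲ`.
      rcases Nat.eq_zero_or_pos j with rfl | hj0
      · refine ⟨(sqNorm 0 (derivSeq r.seq)).toNNReal, fun k => ?_⟩
        rw [ENNReal.coe_toNNReal hr', mul_comm]
        refine (hL2 k _ hr').trans ?_
        gcongr
      · have hD : sqNorm j (derivSeq r.seq) ≠ ⊤ := by
          refine ne_top_of_le_ne_top r.sqNorm_seq_ne_top ?_
          refine (sqNorm_mono (l := s - 1) ?_ _).trans (sqNorm_derivSeq_le s _)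
          push_cast at hj; omega
        refine ⟨(mulConst j * C * sqNorm j (derivSeq r.seq)).toNNReal, fun k => ?_⟩
        rw [ENNReal.coe_toNNReal (ENNReal.mul_ne_top (ENNReal.mul_ne_top (mulConst_ne_top _)
          ENNReal.coe_ne_top) hD)]
        refine (sqNorm_conv_le (s := j) (by omega) (by simp) _ _).trans ?_
        calc _ ≤ mulConst j * (C * ((ρ' : ℝ≥0∞) ^ k) ^ 2) * sqNorm j (derivSeq r.seq) := by
              gcongr; exact hC k
          _ = _ := by ring
    obtain ⟨B, hB⟩ := hconv
    obtain ⟨K, hK⟩ := exists_mul_pow_le h2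
    refine ⟨1 + 2 * (K ^ 2 * B), fun k => ?_⟩
    have hder : sqNorm j (derivSeq (npow hs hss r k).seq) ≤
        (K ^ 2 * B : ℝ≥0) * ((ρ : ℝ≥0∞) ^ k) ^ 2 := by
      rcases k with _ | k
      · have : derivSeq (npow hs hss r 0).seq = 0 := by
          funext m
          by_cases hm : m = 0
          · simp [hm, derivSeq]
          · simp [npow, derivSeq, hm]
        rw [this]
        simp [sqNorm, weightedSq]
      · rw [derivSeq_npow_succ, sqNorm_nsmul]
        have hKe : ((k + 1 : ℕ) : ℝ≥0∞) * (ρ' : ℝ≥0∞) ^ k ≤ K * (ρ : ℝ≥0∞) ^ (k + 1) := by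
          have := hK k
          rw [← ENNReal.coe_le_coe] at this
          push_cast at this ⊢
          exact this
        calc _ ≤ ((k + 1 : ℕ) : ℝ≥0∞) ^ 2 * (B * ((ρ' : ℝ≥0∞) ^ k) ^ 2) := by
              gcongr; exact hB k
          _ = (((k + 1 : ℕ) : ℝ≥0∞) * (ρ' : ℝ≥0∞) ^ k) ^ 2 * B := by ring
          _ ≤ (K * (ρ : ℝ≥0∞) ^ (k + 1)) ^ 2 * B := by gcongr
          _ = _ := by push_cast; ring
    refine (sqNorm_le_add_derivSeq _ _).trans ?_
    have e : ((j + 1 : ℕ) : ℤ) - 1 = j := by push_cast; ring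
    rw [e]
    calc _ ≤ ((ρ : ℝ≥0∞) ^ k) ^ 2 + 2 * ((K ^ 2 * B : ℝ≥0) * ((ρ : ℝ≥0∞) ^ k) ^ 2) := by
          refine add_le_add ?_ (mul_le_mul_right hder 2)
          refine (enorm_zero_sq_le_sqNorm 0 _).trans ((hbase k).trans ?_)
          gcongr
      _ = _ := by push_cast; ring

theorem exists_norm_npow_le {c ρ : ℝ≥0} (hc : ∀ θ, |r.val θ| ≤ c) (hρ : c < ρ) :
    ∃ C : ℝ, ∀ k, ‖npow hs hss r k‖ ≤ C * (ρ : ℝ) ^ k := by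
  obtain ⟨j, rfl⟩ := Int.eq_ofNat_of_zero_le (by omega : 0 ≤ s)
  obtain ⟨C, hC⟩ := exists_sqNorm_npow_le hs hss r hc j le_rfl hρ
  refine ⟨√C, fun k => ?_⟩
  refine norm_le_of_sqNorm_le (C := (C : ℝ≥0∞)) ENNReal.coe_ne_top (by positivity) ?_
  rw [← sqNorm_seq, ENNReal.ofReal_pow (NNReal.coe_nonneg ρ), ENNReal.ofReal_coe_nnreal]
  exact hC k

/-- A positive function of class `Hˢ`, `s ≥ 1`, has an inverse square root of class `Hˢ`. -/
theorem exists_inv_sqrt (hs : 1 ≤ s) (q : H 1 s) (hq : ∀ θ, 0 < q.val θ) :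
    ∃ b : H 1 s, ∀ θ, b.val θ = (√(q.val θ))⁻¹ := by
  have hss : |s| ≤ s := by rw [abs_of_nonneg (by omega)]
  have hcont := continuous_val hs q
  obtain ⟨θ₀, -, hmin⟩ := isCompact_univ.exists_isMinOn Set.univ_nonempty hcont.continuousOn
  obtain ⟨θ₁, -, hmax⟩ := isCompact_univ.exists_isMaxOn Set.univ_nonempty hcont.continuousOn
  set δ := q.val θ₀
  set M := q.val θ₁
  have hδ : 0 < δ := hq _
  have hM : 0 < M := hq _
  have hδM : δ ≤ M := hmin (Set.mem_univ θ₁)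
  -- Dividing by the maximum puts `1 + r = q / M` in `[δ / M, 1]`, so `|r| ≤ 1 - δ / M < 1` and
  -- `q^{-1/2} = M^{-1/2} (1 + r)^{-1/2}`.
  set r : H 1 s := M⁻¹ • q - one s
  have hr : ∀ θ, r.val θ = M⁻¹ * q.val θ - 1 := fun θ => by
    have := map_sub (valCLM hs θ) (M⁻¹ • q) (one s)
    simpa [val_smul hs, val_one hs] using this
  have hx : δ / M ≤ 1 := (div_le_one hM).2 hδM
  set c : ℝ≥0 := (1 - δ / M).toNNReal
  have hcv : (c : ℝ) = 1 - δ / M := Real.coe_toNNReal _ (by linarith)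
  have hc : ∀ θ, |r.val θ| ≤ c := by
    intro θ
    rw [hr, hcv, abs_le]
    have h1 : δ ≤ q.val θ := hmin (Set.mem_univ θ)
    have h2 : q.val θ ≤ M := hmax (Set.mem_univ θ)
    have h3 : δ / M ≤ M⁻¹ * q.val θ := by rw [div_eq_inv_mul]; gcongr
    have h4 : M⁻¹ * q.val θ ≤ 1 := by rw [inv_mul_le_iff₀ hM]; linarith
    constructor <;> linarith
  have hc1 : c < 1 := by
    rw [← NNReal.coe_lt_coe, hcv]
    have : 0 < δ / M := by positivity
    simpa
  obtain ⟨ρ, hcρ, hρ1⟩ := exists_between hc1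
  obtain ⟨C, hC⟩ := exists_norm_npow_le hs hss r hc hcρ
  -- Binomial coefficients of `(1 + x)^{-1/2}`. The scalar series converges absolutely at `ρ < 1`,
  -- and `‖rⁿ‖ ≤ C ρⁿ` transfers this to `Hˢ`.
  set b : ℕ → ℝ := fun n => Ring.choose (-(1 / 2) : ℝ) n
  have hser : ∀ x : ℝ, |x| < 1 → HasSum (fun n => b n * x ^ n) ((1 + x) ^ (-(1 / 2) : ℝ)) := by
    intro x hx
    have := (Real.one_add_rpow_hasFPowerSeriesOnBall_zero (a := -(1 / 2))).hasSum (y := x)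
      (by rw [← ENNReal.ofReal_one, Metric.eball_ofReal]; simpa using hx)
    simp only [binomialSeries_apply, List.ofFn_const, List.prod_replicate, smul_eq_mul,
      zero_add] at this
    exact this
  have hbs : Summable fun n => ‖b n • npow hs hss r n‖ := by
    have hρa := (hser ρ (by rw [abs_of_nonneg (NNReal.coe_nonneg ρ)]; exact hρ1)).summable.abs.mul_left C
    refine Summable.of_nonneg_of_le (fun n => norm_nonneg _) (fun n => ?_) hρa
    rw [norm_smul, Real.norm_eq_abs, abs_mul, abs_pow, abs_of_nonneg (NNReal.coe_nonneg ρ)]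
    calc |b n| * ‖npow hs hss r n‖ ≤ |b n| * (C * (ρ : ℝ) ^ n) := by gcongr; exact hC n
      _ = _ := by ring
  refine ⟨(√M)⁻¹ • ∑' n, b n • npow hs hss r n, fun θ => ?_⟩
  have h1 : (∑' n, b n • npow hs hss r n).val θ = (1 + r.val θ) ^ (-(1 / 2) : ℝ) := by
    have e := (valCLM hs θ).hasSum hbs.of_norm.hasSum
    refine e.unique ?_
    simp only [valCLM_apply, val_smul hs, val_npow]
    exact hser _ ((hc θ).trans_lt (by exact_mod_cast hc1))
  have hpos : 0 ≤ M⁻¹ * q.val θ := mul_nonneg (by positivity) (hq θ).le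
  rw [val_smul hs, h1, hr, add_sub_cancel, Real.rpow_neg hpos, ← Real.sqrt_eq_rpow, ← mul_inv,
    ← Real.sqrt_mul hM.le, mul_inv_cancel_left₀ hM.ne']

end H

/-! ### Smooth dependence of the inverse square root -/

namespace H

variable {s : ℤ}

/-- The positive functions of class `Hˢ`. -/
def positive (s : ℤ) : Set (H 1 s) := {q | ∀ θ, 0 < q.val θ}

open Classical in
/-- The inverse square root of a positive function. -/
def invSqrt (q : H 1 s) : H 1 s :=
  if h : ∃ b : H 1 s, ∀ θ, b.val θ = (√(q.val θ))⁻¹ then h.choose else 0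

theorem val_invSqrt (hs : 1 ≤ s) {q : H 1 s} (hq : q ∈ positive s) (θ : Circle2π) :
    (invSqrt q).val θ = (√(q.val θ))⁻¹ := by
  have h := exists_inv_sqrt hs q hq
  rw [invSqrt, dif_pos h]
  exact h.choose_spec θ

theorem mul_one_left {d : ℕ} {k : ℤ} (hs : 1 ≤ s) (hk : |k| ≤ s) (u : H d k) :
    mul d hs hk (one s) u = u :=
  coeff_injective <| by rw [coeff_mul, seq_one, conv_single_zero]

theorem mul_one_eq_id {d : ℕ} {k : ℤ} (hs : 1 ≤ s) (hk : |k| ≤ s) :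
    mul d hs hk (one s) = ContinuousLinearEquiv.refl ℝ (H d k) :=
  ContinuousLinearMap.ext fun u => mul_one_left hs hk u

/-- Multiplicative inversion is smooth near `1`. -/
theorem exists_smooth_inv_near_one (hs : 1 ≤ s) (hss : |s| ≤ s) :
    ∃ G : H 1 s → H 1 s, ContDiffAt ℝ ∞ G (one s) ∧ G (one s) = one s ∧
      ∀ᶠ t in 𝓝 (one s), mul 1 hs hss t (G t) = one s := by
  set m := mul 1 hs hss
  have hm1 : m (one s) = ContinuousLinearEquiv.refl ℝ (H 1 s) := mul_one_eq_id hs hss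
  -- The inverse of `t` is the solution `x` of `t x = 1`, so it inherits smoothness from inversion
  -- of the multiplication operator `m t`.
  refine ⟨fun t => (m t).inverse (one s), ?_, ?_, ?_⟩
  · refine ContDiffAt.clm_apply ?_ contDiffAt_const
    refine ContDiffAt.comp (one s) (g := ContinuousLinearMap.inverse) (f := m) ?_
      m.contDiff.contDiffAt
    rw [hm1]
    exact contDiffAt_map_inverse _
  · change (m (one s)).inverse (one s) = one s
    rw [hm1, ContinuousLinearMap.inverse_equiv]
    rfl
  · have h1 : ∀ᶠ t in 𝓝 (one s), m t ∈
        Set.range ((↑) : (H 1 s ≃L[ℝ] H 1 s) → H 1 s →L[ℝ] H 1 s) := by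
      refine m.continuous.continuousAt.eventually ?_
      rw [hm1]
      exact ContinuousLinearEquiv.nhds _
    filter_upwards [h1] with t ht
    obtain ⟨e, he⟩ := ht
    rw [← he, ContinuousLinearMap.inverse_equiv]
    exact e.apply_symm_apply _

/-- The square root is smooth near `1`. -/
theorem exists_smooth_sqrt_near_one (hs : 1 ≤ s) (hss : |s| ≤ s) :
    ∃ S : H 1 s → H 1 s, ContDiffAt ℝ ∞ S (one s) ∧ S (one s) = one s ∧
      ∀ᶠ t in 𝓝 (one s), mul 1 hs hss (S t) (S t) = t := by
  set m := mul 1 hs hss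
  have hm1 : m (one s) = ContinuousLinearEquiv.refl ℝ (H 1 s) := mul_one_eq_id hs hss
  have h11 : m (one s) (one s) = one s := mul_one_left hs hss _
  have hflip : ∀ a b, m a b = m b a := fun a b => val_injective hs <| by
    funext θ; rw [val_mul, val_mul, mul_comm]
  set e : H 1 s ≃L[ℝ] H 1 s :=
    ContinuousLinearEquiv.smulLeft (Units.mk0 (2 : ℝ) two_ne_zero)
  have hf : ContDiffAt ℝ ∞ (fun v => m v v) (one s) :=
    (m.contDiff.clm_apply contDiff_id).contDiffAt
  -- Squaring has derivative `v ↦ 2 v` at `1`, an isomorphism, so the inverse function theorem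
  -- provides the root.
  have hf' : HasFDerivAt (fun v => m v v) (e : H 1 s →L[ℝ] H 1 s) (one s) := by
    have h := (m.hasFDerivAt (x := one s)).clm_apply (hasFDerivAt_id (one s))
    refine h.congr_fderiv (ContinuousLinearMap.ext fun v => ?_)
    have e1 : e v = (2 : ℝ) • v := rfl
    simp only [add_apply, ContinuousLinearMap.comp_apply,
      ContinuousLinearMap.flip_apply, id_eq, ContinuousLinearEquiv.coe_coe]
    rw [e1, hflip v, hm1, two_smul]
    rfl
  have hn : (∞ : WithTop ℕ∞) ≠ 0 := by simp
  refine ⟨hf.localInverse hf' hn, ?_, ?_, ?_⟩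
  · have := hf.to_localInverse hf' hn
    simp only [h11] at this
    exact this
  · have := hf.localInverse_apply_image hf' hn
    simp only [h11] at this
    exact this
  · have := (hf.hasStrictFDerivAt' hf' hn).eventually_right_inverse
    simp only [h11] at this
    exact this

/-- Near `q₀` one has `q^{-1/2} = q₀^{-1/2} · √((q / q₀)⁻¹)`. The quotient `q / q₀` is linear in `q`
and close to `1`, so the local inverse and the local square root apply. This identifies the chosen
`invSqrt` with a smooth expression. -/
theorem contDiffOn_invSqrt (hs : 1 ≤ s) : ContDiffOn ℝ ∞ (invSqrt (s := s)) (positive s) := by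
  have hss : |s| ≤ s := by rw [abs_of_nonneg (by omega)]
  intro q₀ hq₀
  obtain ⟨G, hG, hG1, hGe⟩ := exists_smooth_inv_near_one hs hss
  obtain ⟨S, hS, hS1, hSe⟩ := exists_smooth_sqrt_near_one hs hss
  set m := mul 1 hs hss
  set b := invSqrt q₀
  have hb : ∀ θ, b.val θ = (√(q₀.val θ))⁻¹ := val_invSqrt hs hq₀
  set τ : H 1 s →L[ℝ] H 1 s := (m b).comp (m b)
  have hτv : ∀ q θ, (τ q).val θ = (q₀.val θ)⁻¹ * q.val θ := fun q θ => by
    change (m b (m b q)).val θ = _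
    rw [val_mul, val_mul, hb, ← mul_assoc, ← mul_inv, Real.mul_self_sqrt (hq₀ θ).le]
  have hτ : τ q₀ = one s := val_injective hs <| by
    funext θ
    rw [hτv, val_one hs, inv_mul_cancel₀ (hq₀ θ).ne']
  have hτc : Tendsto τ (𝓝 q₀) (𝓝 (one s)) := by
    rw [← hτ]; exact τ.continuous.continuousAt
  have hGc : Tendsto G (𝓝 (one s)) (𝓝 (one s)) := by
    have := hG.continuousAt.tendsto
    rwa [hG1] at this
  have hSc : Tendsto S (𝓝 (one s)) (𝓝 (one s)) := by
    have := hS.continuousAt.tendsto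
    rwa [hS1] at this
  -- By the Sobolev embedding, functions near `1` in `Hˢ` are pointwise positive. This selects the
  -- positive root among the pointwise solutions of `x² = (q / q₀)⁻¹`.
  have hposS : ∀ᶠ v in 𝓝 (one s), ∀ θ, 0 < v.val θ := by
    have hε : 0 < 1 / (embConst + 1) := by
      have : 0 ≤ embConst := Real.sqrt_nonneg _
      positivity
    filter_upwards [Metric.ball_mem_nhds (one s) hε] with v hv θ
    have h1 := abs_val_le hs (v - one s) θ
    have h2 := map_sub (valCLM hs θ) v (one s)
    simp only [valCLM_apply, val_one hs] at h2
    have h3 : embConst * ‖v - one s‖ < 1 := by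
      rw [mem_ball_iff_norm, lt_div_iff₀ (by have : 0 ≤ embConst := Real.sqrt_nonneg _; positivity)]
        at hv
      nlinarith [norm_nonneg (v - one s)]
    rw [h2] at h1
    have := (abs_lt.1 (h1.trans_lt h3)).1
    linarith
  have hsm : ContDiffAt ℝ ∞ (fun q => m b (S (G (τ q)))) q₀ := by
    have h1 : ContDiffAt ℝ ∞ (G ∘ τ) q₀ :=
      ContDiffAt.comp q₀ (by rw [hτ]; exact hG) τ.contDiff.contDiffAt
    have h2 : ContDiffAt ℝ ∞ (S ∘ (G ∘ τ)) q₀ :=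
      ContDiffAt.comp q₀ (by rw [Function.comp_apply, hτ, hG1]; exact hS) h1
    exact (m b).contDiff.contDiffAt.comp q₀ h2
  have hev : ∀ᶠ q in 𝓝 q₀, mul 1 hs hss (τ q) (G (τ q)) = one s ∧
      mul 1 hs hss (S (G (τ q))) (S (G (τ q))) = G (τ q) ∧ ∀ θ, 0 < (S (G (τ q))).val θ :=
    (hτc.eventually hGe).and (((hGc.comp hτc).eventually hSe).and
      ((hSc.comp (hGc.comp hτc)).eventually hposS))
  have heq : ∀ q ∈ positive s, (mul 1 hs hss (τ q) (G (τ q)) = one s ∧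
      mul 1 hs hss (S (G (τ q))) (S (G (τ q))) = G (τ q) ∧ ∀ θ, 0 < (S (G (τ q))).val θ) →
      invSqrt q = m b (S (G (τ q))) := by
    rintro q hq ⟨h1, h2, h3⟩
    refine val_injective hs (funext fun θ => ?_)
    rw [val_invSqrt hs hq, val_mul, hb]
    have e1 := congrArg (fun v => H.val v θ) h1
    have e2 := congrArg (fun v => H.val v θ) h2
    simp only [val_mul, val_one hs, hτv] at e1 e2
    have hx := h3 θ
    generalize (S (G (τ q))).val θ = x at *
    rw [← e2] at e1
    have hq0 := hq₀ θ
    have hqq := hq θ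
    have hxe : x = √(q₀.val θ) / √(q.val θ) := by
      rw [← Real.sqrt_div hq0.le, eq_comm, Real.sqrt_eq_iff_mul_self_eq (by positivity) hx.le]
      field_simp at e1 ⊢
      linarith
    have : 0 < √(q₀.val θ) := Real.sqrt_pos.2 hq0
    rw [hxe]
    field_simp
  refine hsm.contDiffWithinAt.congr_of_eventuallyEq ?_ ?_
  · filter_upwards [nhdsWithin_le_nhds hev, self_mem_nhdsWithin] with q h1 h2
    exact heq q h2 h1
  · exact heq q₀ hq₀ hev.self_of_nhds

end H

/-! ### The speed of an immersion and smooth families of operators -/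

namespace H

variable {p : ℤ}

/-- The derivative `c'` of a curve, by components. -/
def velocity (p : ℤ) (j : Fin 2) : H 2 p →L[ℝ] H 1 (p - 1) :=
  (component (p - 1) j).comp (deriv 2 (by omega))

theorem val_velocity (c : H 2 p) (j : Fin 2) (θ : Circle2π) :
    (velocity p j c).val θ = eval (dTheta c.coeff) θ j := rfl

/-- The function `|c'|²`. -/
def speedSq (hp : 2 ≤ p) (hs : |p - 1| ≤ p - 1) (c : H 2 p) : H 1 (p - 1) :=
  mul 1 (by omega) hs (velocity p 0 c) (velocity p 0 c) +
    mul 1 (by omega) hs (velocity p 1 c) (velocity p 1 c)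

variable (hp : 2 ≤ p) (hs : |p - 1| ≤ p - 1)

theorem val_speedSq (c : H 2 p) (θ : Circle2π) : (speedSq hp hs c).val θ = speed c θ ^ 2 := by
  rw [speedSq, val_add (by omega), val_mul, val_mul, val_velocity, val_velocity, speed,
    EuclideanSpace.norm_sq_eq, Fin.sum_univ_two]
  simp [sq]

theorem speed_pos {c : H 2 p} (hc : c ∈ Imm p) (θ : Circle2π) : 0 < speed c θ :=
  norm_pos_iff.2 (hc θ)

theorem speedSq_mem_positive {c : H 2 p} (hc : c ∈ Imm p) : speedSq hp hs c ∈ positive (p - 1) :=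
  fun θ => by rw [val_speedSq]; exact pow_pos (speed_pos hc θ) 2

theorem contDiff_speedSq : ContDiff ℝ ∞ (speedSq hp hs) := by
  unfold speedSq
  refine ContDiff.add ?_ ?_ <;>
  exact ((ContinuousLinearMap.contDiff _).comp (ContinuousLinearMap.contDiff _)).clm_apply
    (ContinuousLinearMap.contDiff _)

/-- The function `1 / |c'|`. -/
def invSpeed (c : H 2 p) : H 1 (p - 1) := invSqrt (speedSq hp hs c)

/-- The function `|c'|` as an element of `Hᵖ⁻¹`. -/
def speedFn (c : H 2 p) : H 1 (p - 1) :=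
  mul 1 (by omega) hs (speedSq hp hs c) (invSpeed hp hs c)

theorem val_invSpeed {c : H 2 p} (hc : c ∈ Imm p) (θ : Circle2π) :
    (invSpeed hp hs c).val θ = (speed c θ)⁻¹ := by
  rw [invSpeed, val_invSqrt (by omega) (speedSq_mem_positive hp hs hc), val_speedSq,
    Real.sqrt_sq (speed_pos hc θ).le]

theorem val_speedFn {c : H 2 p} (hc : c ∈ Imm p) (θ : Circle2π) :
    (speedFn hp hs c).val θ = speed c θ := by
  have := (speed_pos hc θ).ne'
  rw [speedFn, val_mul, val_invSpeed hp hs hc, val_speedSq]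
  field_simp

theorem contDiffOn_invSpeed : ContDiffOn ℝ ∞ (invSpeed hp hs) (Imm p) :=
  (contDiffOn_invSqrt (by omega)).comp (contDiff_speedSq hp hs).contDiffOn
    fun _ hc => speedSq_mem_positive hp hs hc

theorem contDiffOn_speedFn : ContDiffOn ℝ ∞ (speedFn hp hs) (Imm p) := by
  unfold speedFn
  exact ((ContinuousLinearMap.contDiff _).comp (contDiff_speedSq hp hs)).contDiffOn.clm_apply
    (contDiffOn_invSpeed hp hs)

theorem mulFun_speed {d : ℕ} {c : H 2 p} (hc : c ∈ Imm p) (u : Coeffs d) :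
    mulFun (speed c) u = conv (speedFn hp hs c).seq u := by
  rw [← fourierCoeff_val (by omega), funext (val_speedFn hp hs hc)]
  rfl

theorem mulFun_invSpeed {d : ℕ} {c : H 2 p} (hc : c ∈ Imm p) (u : Coeffs d) :
    mulFun (fun θ => (speed c θ)⁻¹) u = conv (invSpeed hp hs c).seq u := by
  rw [← fourierCoeff_val (by omega), funext (val_invSpeed hp hs hc)]
  rfl

theorem mul_speedFn_invSpeed {c : H 2 p} (hc : c ∈ Imm p) :
    mul 1 (by omega) hs (speedFn hp hs c) (invSpeed hp hs c) = one (p - 1) :=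
  val_injective (by omega) <| funext fun θ => by
    rw [val_mul, val_speedFn hp hs hc, val_invSpeed hp hs hc, val_one (by omega),
      mul_inv_cancel₀ (speed_pos hc θ).ne']

theorem mul_invSpeed_speedFn {c : H 2 p} (hc : c ∈ Imm p) :
    mul 1 (by omega) hs (invSpeed hp hs c) (speedFn hp hs c) = one (p - 1) :=
  val_injective (by omega) <| funext fun θ => by
    rw [val_mul, val_speedFn hp hs hc, val_invSpeed hp hs hc, val_one (by omega),
      inv_mul_cancel₀ (speed_pos hc θ).ne']

theorem speedFn_mem_positive {c : H 2 p} (hc : c ∈ Imm p) : speedFn hp hs c ∈ positive (p - 1) :=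
  fun θ => by rw [val_speedFn hp hs hc]; exact speed_pos hc θ

end H

/-- The operators `T c`, `c ∈ Immᵖ`, restrict to bounded operators `Hᵏ → Hˡ` depending smoothly
on `c`. -/
def IsSmoothFamily {p : ℤ} {d : ℕ} (k l : ℤ) (T : H 2 p → Coeffs d → Coeffs d) : Prop :=
  ∃ F : H 2 p → H d k →L[ℝ] H d l, ContDiffOn ℝ ∞ F (Imm p) ∧
    ∀ c ∈ Imm p, ∀ h : H d k, (F c h).coeff = T c h.coeff

namespace IsSmoothFamily

variable {p : ℤ} {d : ℕ} {k l m : ℤ} {S T : H 2 p → Coeffs d → Coeffs d}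

theorem comp (hS : IsSmoothFamily l m S) (hT : IsSmoothFamily k l T) :
    IsSmoothFamily k m fun c u => S c (T c u) := by
  obtain ⟨F, hF, hF'⟩ := hS
  obtain ⟨G, hG, hG'⟩ := hT
  exact ⟨fun c => (F c).comp (G c), hF.clm_comp hG, fun c hc h => by
    rw [ContinuousLinearMap.comp_apply, hF' c hc, hG' c hc]⟩

theorem congr (hT : IsSmoothFamily k l T) (h : ∀ c u, S c u = T c u) : IsSmoothFamily k l S := by
  obtain rfl : S = T := funext fun c => funext (h c)
  exact hT

theorem inclusion (h : l ≤ k) : IsSmoothFamily (p := p) (d := d) k l fun _ u => u :=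
  ⟨fun _ => H.incl d h, contDiffOn_const, fun _ _ _ => H.coeff_incl h _⟩

theorem derivative (h : l + 1 ≤ k) : IsSmoothFamily (p := p) (d := d) k l fun _ u => dTheta u :=
  ⟨fun _ => H.deriv d h, contDiffOn_const, fun _ _ _ => H.coeff_deriv h _⟩

theorem mono_right {l' : ℤ} (hT : IsSmoothFamily k l T) (h : l' ≤ l) : IsSmoothFamily k l' T :=
  (inclusion h).comp hT

theorem neg (hT : IsSmoothFamily k l T) : IsSmoothFamily k l fun c u => -T c u := by
  obtain ⟨F, hF, hF'⟩ := hT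
  exact ⟨fun c => -F c, hF.neg, fun c hc h => by
    rw [neg_apply, H.coeff_neg, hF' c hc]⟩

theorem const_smul (r : ℝ) (hT : IsSmoothFamily k l T) : IsSmoothFamily k l fun c u => r • T c u := by
  obtain ⟨F, hF, hF'⟩ := hT
  exact ⟨fun c => r • F c, hF.const_smul r, fun c hc h => by
    rw [smul_apply, H.coeff_smul, hF' c hc]⟩

theorem sum {ι : Type*} (I : Finset ι) {T : ι → H 2 p → Coeffs d → Coeffs d}
    (hT : ∀ i ∈ I, IsSmoothFamily k l (T i)) : IsSmoothFamily k l fun c u => ∑ i ∈ I, T i c u := by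
  classical
  choose! F hF hF' using hT
  exact ⟨fun c => ∑ i ∈ I, F i c, ContDiffOn.sum fun i hi => hF i hi, fun c hc h => by
    rw [sum_apply, H.coeff_sum]
    exact Finset.sum_congr rfl fun i hi => hF' i hi c hc h⟩

theorem mulFun_speed (hp : 2 ≤ p) (hk : |k| ≤ p - 1) :
    IsSmoothFamily (p := p) (d := d) k k fun c u => mulFun (speed c) u := by
  have hs : |p - 1| ≤ p - 1 := by rw [abs_of_nonneg (by omega)]
  refine ⟨fun c => H.mul d (by omega) hk (H.speedFn hp hs c),
    (H.mul d (by omega) hk).contDiff.comp_contDiffOn (H.contDiffOn_speedFn hp hs),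
    fun c hc h => ?_⟩
  rw [H.coeff_mul]
  exact (H.mulFun_speed hp hs hc _).symm

theorem mulFun_invSpeed (hp : 2 ≤ p) (hk : |k| ≤ p - 1) :
    IsSmoothFamily (p := p) (d := d) k k fun c u => mulFun (fun θ => (speed c θ)⁻¹) u := by
  have hs : |p - 1| ≤ p - 1 := by rw [abs_of_nonneg (by omega)]
  refine ⟨fun c => H.mul d (by omega) hk (H.invSpeed hp hs c),
    (H.mul d (by omega) hk).contDiff.comp_contDiffOn (H.contDiffOn_invSpeed hp hs),
    fun c hc h => ?_⟩
  rw [H.coeff_mul]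
  exact (H.mulFun_invSpeed hp hs hc _).symm

theorem Ds (hp : 2 ≤ p) (hk : l + 1 ≤ k) (hl : |l| ≤ p - 1) :
    IsSmoothFamily (p := p) (d := d) k l SobolevCurves.Ds :=
  (mulFun_invSpeed hp hl).comp (derivative hk)

theorem DsStar (hp : 2 ≤ p) (hk : |k| ≤ p - 1) (hl : l + 1 ≤ k) :
    IsSmoothFamily (p := p) (d := d) k l SobolevCurves.DsStar :=
  ((derivative hl).comp (mulFun_invSpeed hp hk)).neg

/-- The starting order may be `p`, one above the multiplier range, because `D_s` differentiates
before it multiplies: every multiplication takes place at an order of absolute value at most `p -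
1`. -/
theorem iterate_Ds (hp : 2 ≤ p) (j : ℕ) (hk : k ≤ p) (hj : -(p - 1) ≤ k - j) (hl : l ≤ k - j) :
    IsSmoothFamily (p := p) (d := d) k l fun c => (SobolevCurves.Ds c)^[j] := by
  induction j generalizing l with
  | zero => exact inclusion (by simpa using hl)
  | succ j ih =>
    push_cast at hj hl
    refine IsSmoothFamily.congr (T := fun c u => SobolevCurves.Ds c ((SobolevCurves.Ds c)^[j] u))
      ?_ fun c u => Function.iterate_succ_apply' _ _ _
    have h := (Ds (d := d) hp (l := k - (j + 1)) (k := k - j) (by omega)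
      (abs_le.2 ⟨by omega, by omega⟩)).comp (ih (l := k - j) (by omega) le_rfl)
    exact h.mono_right hl

/-- Dually, the final order may be as low as `-p`, since `D_s*` multiplies first and differentiates
last. -/
theorem iterate_DsStar (hp : 2 ≤ p) (j : ℕ) (hk : |k| ≤ p - 1) (hj : -p ≤ k - j) (hl : l ≤ k - j) :
    IsSmoothFamily (p := p) (d := d) k l fun c => (SobolevCurves.DsStar c)^[j] := by
  obtain ⟨hk1, hk2⟩ := abs_le.1 hk
  induction j generalizing l with
  | zero => exact inclusion (by simpa using hl)
  | succ j ih =>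
    push_cast at hj hl
    refine IsSmoothFamily.congr
      (T := fun c u => SobolevCurves.DsStar c ((SobolevCurves.DsStar c)^[j] u))
      ?_ fun c u => Function.iterate_succ_apply' _ _ _
    have h := (DsStar (d := d) hp (l := k - (j + 1)) (k := k - j)
      (abs_le.2 ⟨by omega, by omega⟩) (by omega)).comp (ih (l := k - j) (by omega) le_rfl)
    exact h.mono_right hl

/-- The summand `(D_s*)ʲ ∘ |c'| ∘ D_sʲ` of the operator `L̄_c`. -/
theorem summand (hp : 2 ≤ p) (j n : ℕ) (hj : j ≤ n) (hn : n ≤ k) (hk : k ≤ p) (hl : l ≤ k - 2 * j)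
    (hl' : l < p) : IsSmoothFamily (p := p) (d := d) k l fun c u =>
      (SobolevCurves.DsStar c)^[j] (mulFun (speed c) ((SobolevCurves.Ds c)^[j] u)) := by
  -- The minimum matters only for `j = 0` and `k = p`, where the argument of `|c'|` would otherwise
  -- have order `p`. The order lost there is harmless since `l < p`.
  have h1 := iterate_Ds (d := d) (k := k) (l := min (k - j) (p - 1)) hp j hk (by omega)
    (min_le_left _ _)
  have hlev : |min (k - j) (p - 1)| ≤ p - 1 := abs_le.2 ⟨by omega, by omega⟩
  have h2 := mulFun_speed (d := d) hp hlev
  have h3 := iterate_DsStar (d := d) (l := l) hp j hlev (by omega) (by omega)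
  exact h3.comp (h2.comp h1)

theorem Lbar (hp : 2 ≤ p) (n : ℕ) (a : ℕ → ℝ) (hn : n ≤ k) (hn1 : 1 ≤ n) (hk : k ≤ p) (hl : l ≤ k - 2 * n) :
    IsSmoothFamily (p := p) (d := d) k l (SobolevCurves.Lbar n a) :=
  sum _ fun j hj => const_smul _ <| by
    have := Finset.mem_range.1 hj
    exact summand hp j n (by omega) hn hk (by omega) (by omega)

end IsSmoothFamily

/-! ### Regularity and coercivity for a fixed speed -/

section sqNorm

variable {V : Type*} [NormedAddCommGroup V]

theorem sqNorm_neg (k : ℤ) (u : ℤ → V) : sqNorm k (-u) = sqNorm k u := by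
  simp [sqNorm]

theorem sqNorm_add_ne_top {k : ℤ} {u v : ℤ → V} (hu : sqNorm k u ≠ ⊤) (hv : sqNorm k v ≠ ⊤) :
    sqNorm k (u + v) ≠ ⊤ := by
  refine ne_top_of_le_ne_top (ENNReal.mul_ne_top ENNReal.ofNat_ne_top
    (ENNReal.add_ne_top.2 ⟨hu, hv⟩) : (2 : ℝ≥0∞) * (sqNorm k u + sqNorm k v) ≠ ⊤) ?_
  rw [sqNorm, sqNorm, sqNorm, weightedSq, weightedSq, weightedSq, ← ENNReal.tsum_add,
    ← ENNReal.tsum_mul_left]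
  refine ENNReal.tsum_le_tsum fun m => le_trans ?_ (add_sq_le_two_mul _ _)
  rw [← mul_add]
  gcongr
  exact enorm_add_le _ _

theorem sqNorm_const_smul_ne_top [NormedSpace ℝ V] {k : ℤ} {u : ℤ → V} (hu : sqNorm k u ≠ ⊤)
    (r : ℝ) : sqNorm k (r • u) ≠ ⊤ := by
  refine ne_top_of_le_ne_top (ENNReal.mul_ne_top (by finiteness : ‖r‖ₑ ^ 2 ≠ ⊤) hu) ?_
  rw [sqNorm, sqNorm, weightedSq, weightedSq, ← ENNReal.tsum_mul_left]
  refine ENNReal.tsum_le_tsum fun m => le_of_eq ?_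
  rw [Pi.smul_apply, enorm_smul]
  ring

theorem sq_tsum_mul_le_weightedSq (k : ℤ) (A B : ℤ → ℝ≥0∞) :
    (∑' m, A m * B m) ^ 2 ≤ weightedSq k A * weightedSq (-k) B := by
  have h : ∀ m, A m * B m = (eweight k m * A m) * (eweight (-k) m * B m) := fun m => by
    rw [mul_mul_mul_comm, ← eweight_add]; simp
  simp_rw [h]
  exact sq_tsum_mul_le _ _

end sqNorm

/-! ### The duality pairing. -/

section pairing

variable {V : Type*} [NormedAddCommGroup V] [InnerProductSpace ℂ V]

/-- The duality pairing `∑ₘ ⟨u m, v m⟩` between `H⁻ᵏ` and `Hᵏ`. -/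
def pairing (u v : ℤ → V) : ℂ := ∑' m, inner ℂ (u m) (v m)

theorem pairing_derivSeq (u v : ℤ → V) : pairing (-derivSeq u) v = pairing u (derivSeq v) := by
  refine tsum_congr fun m => ?_
  simp [derivSeq, inner_smul_left]

/-- For real `a` the convolution matrix `a (m - l)` is Hermitian. Exchanging the sums is justified
by the multiplication estimate and Cauchy-Schwarz between `Hᵏ` and `H⁻ᵏ`. -/
theorem pairing_conv [CompleteSpace V] {s k : ℤ} (hs : 1 ≤ s) (hk : |k| ≤ s) {a : ℤ → ℂ}
    (hr : ∀ m, a (-m) = conj (a m)) (ha : sqNorm s a ≠ ⊤) {u v : ℤ → V} (hu : sqNorm k u ≠ ⊤)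
    (hv : sqNorm (-k) v ≠ ⊤) : pairing (conv a u) v = pairing u (conv a v) := by
  have hsum : Summable fun x : ℤ × ℤ => a (x.2 - x.1) * inner ℂ (u x.2) (v x.1) := by
    apply summable_of_tsum_enorm_ne_top
    have h1 : weightedSq k (fun m => ∑' l, ‖a (m - l)‖ₑ * ‖u l‖ₑ) ≠ ⊤ := ne_top_of_le_ne_top
      (ENNReal.mul_ne_top (ENNReal.mul_ne_top (mulConst_ne_top s) ha) hu)
      (weightedSq_conv_le hs hk (fun m => ‖a m‖ₑ) fun m => ‖u m‖ₑ)
    have h2 := ne_top_of_le_ne_top (ENNReal.mul_ne_top h1 hv)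
      (sq_tsum_mul_le_weightedSq k (fun m => ∑' l, ‖a (m - l)‖ₑ * ‖u l‖ₑ) fun m => ‖v m‖ₑ)
    have h3 : ∑' m, (∑' l, ‖a (m - l)‖ₑ * ‖u l‖ₑ) * ‖v m‖ₑ ≠ ⊤ := by simpa using h2
    refine ne_top_of_le_ne_top h3 ?_
    rw [ENNReal.tsum_prod']
    refine ENNReal.tsum_le_tsum fun m => ?_
    rw [← ENNReal.tsum_mul_right]
    refine ENNReal.tsum_le_tsum fun l => ?_
    have e : ‖a (l - m)‖ₑ = ‖a (m - l)‖ₑ := by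
      rw [← neg_sub m l, hr, ← ofReal_norm, RCLike.norm_conj, ofReal_norm]
    rw [enorm_mul, e, mul_assoc]
    gcongr
    rw [← ofReal_norm, ← ofReal_norm, ← ofReal_norm, ← ENNReal.ofReal_mul (norm_nonneg _)]
    exact ENNReal.ofReal_le_ofReal (norm_inner_le_norm _ _)
  have e1 : ∀ m, inner ℂ (conv a u m) (v m) = ∑' l, a (l - m) * inner ℂ (u l) (v m) := by
    intro m
    rw [← inner_conj_symm]
    have h : inner ℂ (v m) (conv a u m) = ∑' l, inner ℂ (v m) (a (m - l) • u l) :=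
      (innerSL ℂ (v m)).map_tsum (summable_conv hs hk ha hu m)
    rw [h, Complex.conj_tsum]
    refine tsum_congr fun l => ?_
    rw [inner_smul_right, map_mul, inner_conj_symm, ← hr, neg_sub]
  have e2 : ∀ m, inner ℂ (u m) (conv a v m) = ∑' l, a (m - l) * inner ℂ (u m) (v l) := by
    intro m
    have h : inner ℂ (u m) (conv a v m) = ∑' l, inner ℂ (u m) (a (m - l) • v l) :=
      (innerSL ℂ (u m)).map_tsum (summable_conv hs (by rwa [abs_neg]) ha hv m)
    rw [h]
    exact tsum_congr fun l => inner_smul_right _ _ _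
  rw [pairing, pairing, tsum_congr e1, tsum_congr e2]
  exact (Summable.tsum_comm (f := fun m l => a (l - m) * inner ℂ (u l) (v m)) hsum).symm

/-- No finiteness is assumed: in the divergent case both sides take the default value `0`. -/
theorem re_pairing_self (u : ℤ → V) :
    (pairing u u).re = (sqNorm 0 u).toReal := by
  have h : sqNorm 0 u = ∑' m, ENNReal.ofReal (‖u m‖ ^ 2) := tsum_congr fun m => by
    rw [eweight_zero_left, one_mul, ENNReal.ofReal_pow (norm_nonneg _), ofReal_norm]
  have hp : pairing u u = ((∑' m, ‖u m‖ ^ 2 : ℝ) : ℂ) := by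
    rw [pairing, Complex.ofReal_tsum]
    exact tsum_congr fun m => by rw [inner_self_eq_norm_sq_to_K]; simp
  rw [hp, Complex.ofReal_re, h, ENNReal.tsum_toReal_eq fun m => ENNReal.ofReal_ne_top]
  exact tsum_congr fun m => (ENNReal.toReal_ofReal (by positivity)).symm

end pairing

/-- The Fourier coefficients of a function and of its inverse. -/
structure InversePair (s : ℤ) (W R : ℤ → ℂ) : Prop where
  one_le : 1 ≤ s
  sqNorm_left : sqNorm s W ≠ ⊤
  sqNorm_right : sqNorm s R ≠ ⊤
  conv_left : conv W R = Pi.single 0 1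
  conv_right : conv R W = Pi.single 0 1

section fixed

variable {V : Type*} [NormedAddCommGroup V] [NormedSpace ℂ V]

/-- The operator `R ∂_θ`. -/
def arcD (R : ℤ → ℂ) (u : ℤ → V) : ℤ → V := conv R (derivSeq u)

/-- The operator `-∂_θ R`. -/
def arcDStar (R : ℤ → ℂ) (u : ℤ → V) : ℤ → V := -derivSeq (conv R u)

theorem sqNorm_derivSeq_ne_top {k l : ℤ} (h : l + 1 ≤ k) {u : ℤ → V} (hu : sqNorm k u ≠ ⊤) :
    sqNorm l (derivSeq u) ≠ ⊤ :=
  ne_top_of_le_ne_top hu ((sqNorm_mono (by omega) _).trans (sqNorm_derivSeq_le k u))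

theorem sqNorm_ne_top_of_derivSeq {l : ℤ} {u : ℤ → V} (h : sqNorm l (derivSeq u) ≠ ⊤) :
    sqNorm (l + 1) u ≠ ⊤ := by
  refine ne_top_of_le_ne_top ?_ (sqNorm_le_add_derivSeq (l + 1) u)
  rw [add_sub_cancel_right]
  exact ENNReal.add_ne_top.2 ⟨by finiteness, ENNReal.mul_ne_top (by norm_num) h⟩

variable [CompleteSpace V]

namespace InversePair

variable {s : ℤ} {W R : ℤ → ℂ} (h : InversePair s W R)
include h

theorem symm : InversePair s R W :=
  ⟨h.one_le, h.sqNorm_right, h.sqNorm_left, h.conv_right, h.conv_left⟩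

theorem cancel {k : ℤ} (hk : |k| ≤ s) {u : ℤ → V} (hu : sqNorm k u ≠ ⊤) :
    conv R (conv W u) = u := by
  rw [conv_assoc h.one_le hk h.sqNorm_right h.sqNorm_left hu, h.conv_right, conv_single_zero]

theorem conv_ne_top {k : ℤ} (hk : |k| ≤ s) {u : ℤ → V} (hu : sqNorm k u ≠ ⊤) :
    sqNorm k (conv W u) ≠ ⊤ :=
  sqNorm_conv_ne_top h.one_le hk h.sqNorm_left hu

/-- Since `u = R * (W * u)`, regularity of `W * u` passes to `u`. The a priori order `k` serves only
to justify associativity. -/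
theorem of_conv {k l : ℤ} (hk : |k| ≤ s) (hl : |l| ≤ s) {u : ℤ → V} (hu : sqNorm k u ≠ ⊤)
    (hWu : sqNorm l (conv W u) ≠ ⊤) : sqNorm l u ≠ ⊤ := by
  rw [← h.cancel hk hu]
  exact h.symm.conv_ne_top hl hWu

theorem arcD_ne_top {k l : ℤ} (hl : |l| ≤ s) (hkl : l + 1 ≤ k) {u : ℤ → V}
    (hu : sqNorm k u ≠ ⊤) : sqNorm l (arcD R u) ≠ ⊤ :=
  h.symm.conv_ne_top hl (sqNorm_derivSeq_ne_top hkl hu)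

theorem iterate_arcD_ne_top {k : ℤ} (j : ℕ) (hk : k ≤ s + 1) (hj : -s ≤ k - j) {u : ℤ → V}
    (hu : sqNorm k u ≠ ⊤) : sqNorm (k - j) ((arcD R)^[j] u) ≠ ⊤ := by
  induction j with
  | zero => simpa using hu
  | succ j ih =>
    rw [Function.iterate_succ_apply']
    push_cast at hj ⊢
    exact h.arcD_ne_top (abs_le.2 ⟨by omega, by omega⟩) (by omega) (ih (by omega))

theorem arcDStar_ne_top {k l : ℤ} (hk : |k| ≤ s) (hl : l + 1 ≤ k) {u : ℤ → V}
    (hu : sqNorm k u ≠ ⊤) : sqNorm l (arcDStar R u) ≠ ⊤ := by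
  rw [arcDStar, sqNorm_neg]
  exact sqNorm_derivSeq_ne_top hl (h.symm.conv_ne_top hk hu)

theorem iterate_arcDStar_ne_top {k : ℤ} (j : ℕ) (hk : |k| ≤ s) (hj : -(s + 1) ≤ k - j)
    {u : ℤ → V} (hu : sqNorm k u ≠ ⊤) : sqNorm (k - j) ((arcDStar R)^[j] u) ≠ ⊤ := by
  obtain ⟨hk1, hk2⟩ := abs_le.1 hk
  induction j with
  | zero => simpa using hu
  | succ j ih =>
    rw [Function.iterate_succ_apply']
    push_cast at hj ⊢
    exact h.arcDStar_ne_top (abs_le.2 ⟨by omega, by omega⟩) (by omega) (ih (by omega))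

/-- Elliptic regularity for powers of `D_s`. -/
theorem of_iterate_arcD {k l : ℤ} (j : ℕ) (hk : k ≤ s + 1) (hkj : -s ≤ k - j) (hl : -s ≤ l)
    (hlj : l + j ≤ s + 1) {u : ℤ → V} (hu : sqNorm k u ≠ ⊤)
    (hD : sqNorm l ((arcD R)^[j] u) ≠ ⊤) : sqNorm (l + j) u ≠ ⊤ := by
  induction j generalizing k u with
  | zero => simpa using hD
  | succ j ih =>
    push_cast at *
    have hk1 : |k - 1| ≤ s := abs_le.2 ⟨by omega, by omega⟩
    have h1 := ih (k := k - 1) (by omega) (by omega) (by omega)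
      (h.arcD_ne_top hk1 (by omega) hu) hD
    have h2 := h.symm.of_conv hk1 (l := l + j) (abs_le.2 ⟨by omega, by omega⟩)
      (sqNorm_derivSeq_ne_top (by omega) hu) h1
    have h3 := sqNorm_ne_top_of_derivSeq h2
    rwa [add_assoc] at h3

/-- Elliptic regularity for powers of `D_s*`. -/
theorem of_iterate_arcDStar {k l : ℤ} (j : ℕ) (hk : |k| ≤ s) (hkj : -(s + 1) ≤ k - j)
    (hl : -s ≤ l + 1) (hlj : l + j ≤ s) {u : ℤ → V} (hu : sqNorm k u ≠ ⊤)
    (hD : sqNorm l ((arcDStar R)^[j] u) ≠ ⊤) : sqNorm (l + j) u ≠ ⊤ := by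
  obtain ⟨hk1, hk2⟩ := abs_le.1 hk
  induction j generalizing l with
  | zero => simpa using hD
  | succ j ih =>
    push_cast at *
    rw [Function.iterate_succ_apply', arcDStar, sqNorm_neg] at hD
    have h1 := h.symm.of_conv (k := k - j) (l := l + 1) (abs_le.2 ⟨by omega, by omega⟩)
      (abs_le.2 ⟨by omega, by omega⟩) (h.iterate_arcDStar_ne_top j hk (by omega) hu)
      (sqNorm_ne_top_of_derivSeq hD)
    have h2 := ih (by omega) (by omega) (by omega) h1
    rwa [add_assoc, add_comm 1] at h2

/-- Poincaré inequality for functions with vanishing weighted mean. -/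
theorem poincare (hW : W 0 ≠ 0) : ∃ K : ℝ≥0∞, K ≠ ⊤ ∧ ∀ g : ℤ → V, sqNorm 0 g ≠ ⊤ →
    conv W g 0 = 0 → sqNorm 0 g ≤ K * sqNorm 0 (derivSeq g) := by
  have hW' : ‖W 0‖ₑ ≠ 0 := by simpa using hW
  have hWs : sqNorm 0 W ≠ ⊤ := sqNorm_ne_top_mono (by have := h.one_le; omega) h.sqNorm_left
  refine ⟨(‖W 0‖ₑ ^ 2)⁻¹ * sqNorm 0 W + 1, by finiteness, fun g hg h0 => ?_⟩
  have hsum := summable_conv h.one_le (by have := h.one_le; simp; omega) h.sqNorm_left hg 0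
  -- The vanishing mean is solved for `g 0` in terms of the other modes, on which `|g l| ≤ |g' l|`.
  have e1 : W 0 • g 0 = -∑' l, if l = 0 then 0 else W (0 - l) • g l := by
    rw [conv, hsum.tsum_eq_add_tsum_ite 0] at h0
    rw [sub_zero] at h0
    exact eq_neg_of_add_eq_zero_left h0
  have e2 : ‖W 0‖ₑ * ‖g 0‖ₑ ≤ ∑' l, ‖W (0 - l)‖ₑ * ‖derivSeq g l‖ₑ := by
    rw [← enorm_smul, e1, enorm_neg]
    refine enorm_tsum_le_tsum_enorm.trans (ENNReal.tsum_le_tsum fun l => ?_)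
    by_cases hl : l = 0
    · simp [hl]
    · rw [if_neg hl, enorm_smul, enorm_derivSeq]
      have h1 : (1 : ℝ≥0∞) ≤ ENNReal.ofReal |(l : ℝ)| := by
        rw [← ENNReal.ofReal_one]
        exact ENNReal.ofReal_le_ofReal (by exact_mod_cast Int.one_le_abs hl)
      gcongr
      calc ‖g l‖ₑ = 1 * ‖g l‖ₑ := (one_mul _).symm
        _ ≤ _ := by gcongr
  have e3 : ‖W 0‖ₑ ^ 2 * ‖g 0‖ₑ ^ 2 ≤ sqNorm 0 W * sqNorm 0 (derivSeq g) := by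
    rw [← mul_pow]
    refine (pow_le_pow_left' e2 2).trans ((sq_tsum_mul_le _ _).trans ?_)
    rw [tsum_sub_left_int fun l => ‖W l‖ₑ ^ 2]
    simp [sqNorm, weightedSq]
  have e4 : ‖g 0‖ₑ ^ 2 ≤ (‖W 0‖ₑ ^ 2)⁻¹ * (sqNorm 0 W * sqNorm 0 (derivSeq g)) := by
    rw [← ENNReal.mul_le_iff_le_inv (by simpa using hW) (by finiteness)]
    exact e3
  have e5 : sqNorm 0 g ≤ ‖g 0‖ₑ ^ 2 + sqNorm 0 (derivSeq g) := by
    simpa [sqNorm, weightedSq] using sqNorm_zero_le_derivSeq g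
  refine e5.trans ?_
  rw [add_mul, one_mul, mul_assoc]
  gcongr

/-- A function with vanishing weighted mean is controlled by the top order arc length
derivative. -/
theorem sqNorm_le_iterate_arcD (hW : W 0 ≠ 0) : ∃ K : ℝ≥0∞, K ≠ ⊤ ∧ ∀ (k : ℕ) (g : ℤ → V),
    (k : ℤ) ≤ s + 1 → sqNorm k g ≠ ⊤ → conv W g 0 = 0 →
      sqNorm k g ≤ K ^ k * sqNorm 0 ((arcD R)^[k] g) := by
  obtain ⟨P, hP, hPg⟩ := h.poincare (V := V) hW
  have h1s := h.one_le
  refine ⟨(P + 2) * (mulConst s * sqNorm s W), ENNReal.mul_ne_top (by finiteness)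
    (ENNReal.mul_ne_top (mulConst_ne_top s) h.sqNorm_left), fun k => ?_⟩
  induction k with
  | zero => intro g _ _ _; simp
  | succ k ih =>
    intro g hk hg h0
    push_cast at hk hg ⊢
    have hks : |(k : ℤ)| ≤ s := abs_le.2 ⟨by omega, by omega⟩
    have hder := sqNorm_derivSeq_ne_top (l := k) le_rfl hg
    have hcan : conv W (arcD R g) = derivSeq g := h.symm.cancel hks hder
    have hg' : sqNorm k (arcD R g) ≠ ⊤ := h.arcD_ne_top hks le_rfl hg
    -- The mean condition is automatic for `D_s g`: multiplied by `W` it becomes `g'`, whose zero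
    -- mode vanishes.
    have hih := ih (arcD R g) (by omega) hg' (by rw [hcan]; simp [derivSeq])
    have hp := hPg g (sqNorm_ne_top_mono (by omega) hg) h0
    have hm : sqNorm k (derivSeq g) ≤ mulConst s * sqNorm s W * sqNorm k (arcD R g) := by
      rw [← hcan]
      exact sqNorm_conv_le h1s hks W (arcD R g)
    have h1 := sqNorm_le_add_derivSeq ((k : ℤ) + 1) g
    rw [add_sub_cancel_right] at h1
    calc sqNorm ((k : ℤ) + 1) g ≤ P * sqNorm k (derivSeq g) + 2 * sqNorm k (derivSeq g) := by
          refine h1.trans ?_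
          gcongr
          exact ((enorm_zero_sq_le_sqNorm 0 g).trans hp).trans (by
            gcongr; exact sqNorm_mono (by omega) _)
      _ = (P + 2) * sqNorm k (derivSeq g) := by ring
      _ ≤ (P + 2) * (mulConst s * sqNorm s W * sqNorm k (arcD R g)) := by gcongr
      _ ≤ (P + 2) * (mulConst s * sqNorm s W *
          (((P + 2) * (mulConst s * sqNorm s W)) ^ k * sqNorm 0 ((arcD R)^[k] (arcD R g)))) := by
          gcongr
      _ = _ := by rw [Function.iterate_succ_apply]; ring

/-- The `Hⁿ` norm is controlled by the terms of order `0` and `n`. -/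
theorem sqNorm_le_add_iterate_arcD (hW : W 0 ≠ 0) (n : ℕ) (hn : 1 ≤ n) (hns : (n : ℤ) ≤ s + 1) :
    ∃ K : ℝ≥0∞, K ≠ ⊤ ∧ ∀ u : ℤ → V, sqNorm n u ≠ ⊤ →
      sqNorm n u ≤ K * (sqNorm 0 u + sqNorm 0 ((arcD R)^[n] u)) := by
  obtain ⟨K, hK, hKg⟩ := h.sqNorm_le_iterate_arcD (V := V) hW
  obtain ⟨k, rfl⟩ : ∃ k, n = k + 1 := ⟨n - 1, by omega⟩
  have h1s := h.one_le
  refine ⟨1 + 2 * (mulConst s * sqNorm s W * K ^ k), ?_, fun u hu => ?_⟩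
  · exact ENNReal.add_ne_top.2 ⟨by simp, ENNReal.mul_ne_top (by simp) (ENNReal.mul_ne_top
      (ENNReal.mul_ne_top (mulConst_ne_top s) h.sqNorm_left) (by finiteness))⟩
  push_cast at hns hu ⊢
  have hks : |(k : ℤ)| ≤ s := abs_le.2 ⟨by omega, by omega⟩
  have hder := sqNorm_derivSeq_ne_top (l := k) le_rfl hu
  have hcan : conv W (arcD R u) = derivSeq u := h.symm.cancel hks hder
  -- The estimate is applied to `D_s u`, whose weighted mean always vanishes, so `u` itself needs no
  -- condition. The undifferentiated term only has to control the zero mode of `u`.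
  have hih := hKg k (arcD R u) (by omega) (h.arcD_ne_top hks le_rfl hu)
    (by rw [hcan]; simp [derivSeq])
  have hm : sqNorm k (derivSeq u) ≤ mulConst s * sqNorm s W * sqNorm k (arcD R u) := by
    rw [← hcan]
    exact sqNorm_conv_le h1s hks W (arcD R u)
  have h1 := sqNorm_le_add_derivSeq ((k : ℤ) + 1) u
  rw [add_sub_cancel_right] at h1
  set x := sqNorm 0 u
  set y := sqNorm 0 ((arcD R)^[k + 1] u)
  calc _ ≤ x + 2 * (mulConst s * sqNorm s W * (K ^ k * y)) := by
        refine h1.trans (add_le_add (enorm_zero_sq_le_sqNorm 0 u) (mul_le_mul_right ?_ 2))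
        exact hm.trans (mul_le_mul_right hih _)
    _ = 1 * x + 2 * (mulConst s * sqNorm s W * K ^ k) * y := by ring
    _ ≤ (1 + 2 * (mulConst s * sqNorm s W * K ^ k)) * x +
        (1 + 2 * (mulConst s * sqNorm s W * K ^ k)) * y := by
        gcongr
        · exact le_self_add
        · exact le_add_self
    _ = _ := by ring

end InversePair

end fixed

/-- `D_s*` is the transpose of `D_s`. -/
theorem pairing_iterate_arcDStar {V : Type*} [NormedAddCommGroup V] [InnerProductSpace ℂ V]
    [CompleteSpace V] {s : ℤ} {W R : ℤ → ℂ} (h : InversePair s W R)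
    (hr : ∀ m, R (-m) = conj (R m)) (j : ℕ) {i : ℤ} (hi : 0 ≤ i) (hij : i + j ≤ s + 1)
    {u v : ℤ → V} (hu : sqNorm (-i) u ≠ ⊤) (hv : sqNorm (i + j) v ≠ ⊤) :
    pairing ((arcDStar R)^[j] u) v = pairing u ((arcD R)^[j] v) := by
  induction j generalizing i u with
  | zero => rfl
  | succ j ih =>
    push_cast at *
    have hi' : |(-i)| ≤ s := abs_le.2 ⟨by omega, by omega⟩
    -- The innermost `D_s*` is absorbed into `u`, lowering its order from `-i` to `-(i + 1)`. After
    -- the induction hypothesis it is moved across as the outermost `D_s`.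
    rw [Function.iterate_succ_apply, ih (i := i + 1) (by omega) (by omega)
      (h.arcDStar_ne_top hi' (by omega) hu) (by convert hv using 2; ring),
      Function.iterate_succ_apply', arcDStar, pairing_derivSeq]
    have h1 : sqNorm (i + (j + 1) - j) ((arcD R)^[j] v) ≠ ⊤ :=
      h.iterate_arcD_ne_top j (by omega) (by have := h.one_le; omega) hv
    exact pairing_conv h.one_le hi' hr h.sqNorm_right hu
      (by rw [neg_neg]; exact sqNorm_derivSeq_ne_top (by omega) h1)

/-! ### Invertibility of `L̄_c` -/

namespace H

variable {d : ℕ}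

instance (k : ℤ) : InnerProductSpace ℝ (H d k) :=
  { (inferInstance : NormedSpace ℝ (H d k)) with
    inner := fun u v => (inner ℂ (toL2 d k u) (toL2 d k v)).re
    norm_sq_eq_re_inner := fun u => by
      change ‖toL2 d k u‖ ^ 2 = _
      exact norm_sq_eq_re_inner (𝕜 := ℂ) (toL2 d k u)
    conj_inner_symm := fun u v => by
      change (inner ℂ (toL2 d k v) (toL2 d k u)).re = _
      rw [← inner_conj_symm, Complex.conj_re]
    add_left := fun u v w => by
      rw [map_add, inner_add_left, Complex.add_re]
    smul_left := fun u v r => by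
      rw [map_smul, RCLike.real_smul_eq_coe_smul (K := ℂ), inner_smul_left]
      simp }

theorem inner_eq_tsum {k : ℤ} (u v : H d k) : inner ℝ u v =
    (∑' m, inner ℂ (weight k m • u.coeff m) (weight k m • v.coeff m)).re :=
  congrArg Complex.re (lp.inner_eq_tsum (𝕜 := ℂ) (toL2 d k u) (toL2 d k v))

/-- The Riesz isomorphism between `H⁻ᵏ` and `Hᵏ`. -/
def riesz (d : ℕ) (k : ℤ) : H d (-k) →L[ℝ] H d k :=
  ofOperator (fun u m => weight (-(2 * k)) m • u m) 1 ENNReal.one_ne_top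
    (fun u m j => by simp [u.isReal m j, weight_neg_right])
    (fun u => by
      rw [one_mul]
      refine ENNReal.tsum_le_tsum fun m => le_of_eq ?_
      change (eweight k m * ‖weight (-(2 * k)) m • u.coeff m‖ₑ) ^ 2 =
        (eweight (-k) m * ‖u.coeff m‖ₑ) ^ 2
      rw [enorm_weight_smul, ← mul_assoc, ← eweight_add]
      congr 4
      ring)
    (fun u v => funext fun m => smul_add _ (u.coeff m) (v.coeff m))
    fun r u => funext fun m => smul_comm _ r (u.coeff m)

theorem coeff_riesz (k : ℤ) (f : H d (-k)) (m : ℤ) :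
    (riesz d k f).coeff m = weight (-(2 * k)) m • f.coeff m := rfl

theorem riesz_injective (k : ℤ) : Function.Injective (riesz d k) := fun f g hfg =>
  coeff_injective <| funext fun m => by
    have h := congrArg (fun u => u.coeff m) hfg
    simp only [coeff_riesz] at h
    exact smul_right_injective _ (weight_pos _ m).ne' h

theorem inner_riesz (k : ℤ) (f : H d (-k)) (h : H d k) :
    inner ℝ (riesz d k f) h = (pairing f.coeff h.coeff).re := by
  rw [inner_eq_tsum, pairing]
  congr 1
  refine tsum_congr fun m => ?_
  rw [coeff_riesz, RCLike.real_smul_eq_coe_smul (K := ℂ), RCLike.real_smul_eq_coe_smul (K := ℂ),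
    RCLike.real_smul_eq_coe_smul (K := ℂ), inner_smul_left, inner_smul_left, inner_smul_right,
    RCLike.conj_ofReal, RCLike.conj_ofReal, ← mul_assoc, ← mul_assoc, ← RCLike.ofReal_mul,
    ← RCLike.ofReal_mul, ← weight_add, ← weight_add]
  have : k + -(2 * k) + k = 0 := by ring
  simp [this]

/-- Lax-Milgram for operators `Hᵏ → H⁻ᵏ`. -/
theorem bijective_of_coercive {k : ℤ} (L : H d k →L[ℝ] H d (-k)) {C : ℝ} (hC : 0 < C)
    (hL : ∀ h, C * ‖h‖ ^ 2 ≤ (pairing (L h).coeff h.coeff).re) : Function.Bijective L := by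
  -- `B u v` is the real part of the pairing `⟨L u, v⟩`, rewritten as an `Hᵏ` inner product so that
  -- Lax-Milgram on a single Hilbert space applies.
  set B : H d k →L[ℝ] H d k →L[ℝ] ℝ := (innerSL ℝ).comp ((riesz d k).comp L)
  have hB : ∀ u v, B u v = inner ℝ (riesz d k (L u)) v := fun u v => rfl
  have hco : IsCoercive B := ⟨C, hC, fun u => by
    rw [hB, inner_riesz, mul_assoc, ← sq]; exact hL u⟩
  have he : ∀ u, hco.continuousLinearEquivOfBilin u = riesz d k (L u) := fun u =>
    ext_inner_right ℝ fun v => hco.continuousLinearEquivOfBilin_apply u v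
  constructor
  · intro u v huv
    apply hco.continuousLinearEquivOfBilin.injective
    rw [he, he, huv]
  · intro f
    obtain ⟨u, hu⟩ := hco.continuousLinearEquivOfBilin.surjective (riesz d k f)
    exact ⟨u, riesz_injective k (by rw [← he, hu])⟩

end H

/-! ### Coercivity on the energy space and regularity up to `Hᵖ`. -/

section

variable {d : ℕ} {p : ℤ}

open H

theorem inversePair_of_mul {s : ℤ} (hs : 1 ≤ s) (hss : |s| ≤ s) {w r : H 1 s}
    (h1 : mul 1 hs hss w r = one s) (h2 : mul 1 hs hss r w = one s) :
    InversePair s w.seq r.seq :=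
  ⟨hs, w.sqNorm_seq_ne_top, r.sqNorm_seq_ne_top, by rw [← seq_mul hs hss, h1, seq_one],
    by rw [← seq_mul hs hss, h2, seq_one]⟩

/-- Positive functions have invertible square roots. -/
theorem exists_sqrt {s : ℤ} (hs : 1 ≤ s) (hss : |s| ≤ s) {w : H 1 s} (hw : w ∈ positive s) :
    ∃ v b : H 1 s, InversePair s v.seq b.seq ∧ w.seq = conv v.seq v.seq := by
  have hb := val_invSqrt hs hw
  have hpos : ∀ θ, 0 < √(w.val θ) := fun θ => Real.sqrt_pos.2 (hw θ)
  have hv : ∀ θ, (mul 1 hs hss w (invSqrt w)).val θ = √(w.val θ) := fun θ => by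
    rw [val_mul, hb, ← div_eq_mul_inv, Real.div_sqrt]
  refine ⟨mul 1 hs hss w (invSqrt w), invSqrt w, inversePair_of_mul hs hss ?_ ?_, ?_⟩
  · refine val_injective hs (funext fun θ => ?_)
    rw [val_mul, hv, hb, val_one hs, mul_inv_cancel₀ (hpos θ).ne']
  · refine val_injective hs (funext fun θ => ?_)
    rw [val_mul, hv, hb, val_one hs, inv_mul_cancel₀ (hpos θ).ne']
  · rw [← seq_mul hs hss]
    congr 1
    refine val_injective hs (funext fun θ => ?_)
    rw [val_mul, hv, Real.mul_self_sqrt (hw θ).le]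

/-- For real `v` the zero mode of `v²` is the squared `L²` norm of `v`, and an invertible `v` is
nonzero. Applied to `v = √|c'|`, this shows that `|c'|` has nonzero mean. -/
theorem conv_self_zero_ne_zero {s : ℤ} (v b : H 1 s) (h : InversePair s v.seq b.seq) :
    conv v.seq v.seq 0 ≠ 0 := by
  have e : conv v.seq v.seq 0 = pairing v.seq v.seq := tsum_congr fun l => by
    rw [zero_sub, seq_neg_right, smul_eq_mul, RCLike.inner_apply, mul_comm]
  intro h0
  rw [h0] at e
  have h1 := re_pairing_self v.seq
  rw [← e, Complex.zero_re, eq_comm, ENNReal.toReal_eq_zero_iff] at h1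
  rcases h1 with h1 | h1
  · have hv : v.seq = 0 := by
      funext m
      have := ENNReal.tsum_eq_zero.1 h1 m
      simpa using this
    have h2 := congrFun h.conv_left 0
    rw [hv] at h2
    simp [conv] at h2
  · exact sqNorm_zero_seq_ne_top h.one_le v h1

theorem Ds_eq_arcD (hp : 2 ≤ p) (hs : |p - 1| ≤ p - 1) {c : H 2 p} (hc : c ∈ Imm p) :
    Ds (d := d) c = arcD (invSpeed hp hs c).seq :=
  funext fun u => mulFun_invSpeed hp hs hc (dTheta u)

theorem DsStar_eq_arcDStar (hp : 2 ≤ p) (hs : |p - 1| ≤ p - 1) {c : H 2 p} (hc : c ∈ Imm p) :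
    DsStar (d := d) c = arcDStar (invSpeed hp hs c).seq :=
  funext fun u => by
    rw [DsStar, mulFun_invSpeed hp hs hc]
    rfl

/-- The metric `G_c` is coercive on `Hⁿ`. -/
theorem exists_coercive (n : ℕ) (hn : 2 ≤ n) (a : ℕ → ℝ) (ha : ∀ k ≤ n, 0 ≤ a k)
    (ha0 : a 0 ≠ 0) (han : a n ≠ 0) (hnp : (n : ℤ) ≤ p) {c : H 2 p} (hc : c ∈ Imm p)
    (L : H d n →L[ℝ] H d (-n)) (hL : ∀ h, (L h).coeff = Lbar n a c h.coeff) :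
    ∃ C : ℝ, 0 < C ∧ ∀ h, C * ‖h‖ ^ 2 ≤ (pairing (L h).coeff h.coeff).re := by
  have hp : 2 ≤ p := by omega
  have hs : |p - 1| ≤ p - 1 := by rw [abs_of_nonneg (by omega)]
  have hs1 : 1 ≤ p - 1 := by omega
  have hs0 : |(0 : ℤ)| ≤ p - 1 := by simp; omega
  set W := (speedFn hp hs c).seq
  set R := (invSpeed hp hs c).seq
  have hWR : InversePair (p - 1) W R := inversePair_of_mul hs1 hs
    (mul_speedFn_invSpeed hp hs hc) (mul_invSpeed_speedFn hp hs hc)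
  -- With `v = √|c'|`, the form `⟨|c'| g, g⟩` becomes `‖v g‖²` in `L²`. Positivity is thus visible
  -- on Fourier coefficients, without integrals.
  obtain ⟨v, b, hvb, hWv⟩ := exists_sqrt hs1 hs (speedFn_mem_positive hp hs hc)
  have hW0 : W 0 ≠ 0 := by
    have := conv_self_zero_ne_zero v b hvb
    rwa [← hWv] at this
  set N : ℕ → H d n → ℝ := fun j h => (sqNorm 0 (conv v.seq ((arcD R)^[j] h.coeff))).toReal
  have hg : ∀ j ≤ n, ∀ h : H d n, sqNorm 0 ((arcD R)^[j] h.coeff) ≠ ⊤ := fun j hj h =>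
    sqNorm_ne_top_mono (by omega) (hWR.iterate_arcD_ne_top j (by omega) (by omega) h.sqNorm_ne_top)
  have hterm : ∀ j ≤ n, ∀ h : H d n,
      (pairing ((DsStar c)^[j] (mulFun (speed c) ((Ds c)^[j] h.coeff))) h.coeff).re = N j h := by
    intro j hj h
    rw [Ds_eq_arcD hp hs hc, DsStar_eq_arcDStar hp hs hc, H.mulFun_speed hp hs hc]
    rw [pairing_iterate_arcDStar hWR (seq_neg_right _) j le_rfl (by omega)
      (by rw [neg_zero]; exact hWR.conv_ne_top hs0 (hg j hj h))
      (sqNorm_ne_top_mono (by omega) h.sqNorm_ne_top), hWv,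
      ← conv_assoc hs1 hs0 v.sqNorm_seq_ne_top v.sqNorm_seq_ne_top (hg j hj h),
      pairing_conv hs1 hs0 (seq_neg_right v) v.sqNorm_seq_ne_top
        (hvb.conv_ne_top hs0 (hg j hj h)) (by rw [neg_zero]; exact hg j hj h), re_pairing_self]
  have hLsum : ∀ h, (pairing (L h).coeff h.coeff).re = ∑ j ∈ Finset.range (n + 1), a j * N j h := by
    intro h
    -- Each summand is realized in `H⁻ⁿ`, so that additivity of the pairing follows from that of the
    -- inner product through `riesz`.
    have hf : ∀ j ∈ Finset.range (n + 1), ∃ f : H d (-n),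
        f.coeff = (DsStar c)^[j] (mulFun (speed c) ((Ds c)^[j] h.coeff)) := by
      intro j hj
      have := Finset.mem_range.1 hj
      obtain ⟨F, -, hF⟩ := IsSmoothFamily.summand (d := d) (p := p) (k := n) (l := -n) hp j n
        (by omega) le_rfl hnp (by omega) (by omega)
      exact ⟨F c h, hF c hc h⟩
    choose! f hf using hf
    have e : L h = ∑ j ∈ Finset.range (n + 1), a j • f j := coeff_injective <| by
      rw [hL, H.coeff_sum, Lbar]
      exact Finset.sum_congr rfl fun j hj => by rw [H.coeff_smul, hf j hj]
    rw [← inner_riesz, e, map_sum, sum_inner]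
    refine Finset.sum_congr rfl fun j hj => ?_
    rw [map_smul, real_inner_smul_left, inner_riesz, hf j hj,
      hterm j (by have := Finset.mem_range.1 hj; omega)]
  obtain ⟨K, hK, hKu⟩ := hWR.sqNorm_le_add_iterate_arcD (V := EuclideanSpace ℂ (Fin d)) hW0 n
    (by omega) (by omega)
  set K' := mulConst (p - 1) * sqNorm (p - 1) b.seq
  have hK' : K' ≠ ⊤ := ENNReal.mul_ne_top (mulConst_ne_top _) b.sqNorm_seq_ne_top
  -- Multiplication by `b = 1/√|c'|` is bounded on `L²`, so the weight `√|c'|` can be removed.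
  have hgv : ∀ g : Coeffs d, sqNorm 0 g ≠ ⊤ → sqNorm 0 g ≤ K' * sqNorm 0 (conv v.seq g) := by
    intro g hg
    conv_lhs => rw [← hvb.cancel hs0 hg]
    exact sqNorm_conv_le hs1 hs0 _ _
  have hmain : ∀ h : H d n, ‖h‖ ^ 2 ≤ (K * K').toReal * (N 0 h + N n h) := by
    intro h
    have h0 := hg 0 (by omega) h
    have hn' := hg n le_rfl h
    have hv0 := hvb.conv_ne_top hs0 h0
    have hvn := hvb.conv_ne_top hs0 hn'
    have e1 : sqNorm n h.coeff ≤ (K * K') * (sqNorm 0 (conv v.seq ((arcD R)^[0] h.coeff)) +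
        sqNorm 0 (conv v.seq ((arcD R)^[n] h.coeff))) := by
      refine (hKu h.coeff h.sqNorm_ne_top).trans ?_
      rw [mul_assoc, mul_add K']
      gcongr
      · exact hgv _ h0
      · exact hgv _ hn'
    have e2 := ENNReal.toReal_mono (ENNReal.mul_ne_top (ENNReal.mul_ne_top hK hK')
      (ENNReal.add_ne_top.2 ⟨hv0, hvn⟩)) e1
    rw [ENNReal.toReal_mul, ENNReal.toReal_add hv0 hvn, sqNorm_coeff_eq_ofReal,
      ENNReal.toReal_pow, ENNReal.toReal_ofReal (norm_nonneg _)] at e2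
    exact e2
  have hN : ∀ j h, 0 ≤ N j h := fun j h => ENNReal.toReal_nonneg
  set α := min (a 0) (a n)
  have hα : 0 < α := lt_min ((ha 0 (by omega)).lt_of_ne' ha0) ((ha n le_rfl).lt_of_ne' han)
  set M := (K * K').toReal + 1
  have hM : 0 < M := by have : 0 ≤ (K * K').toReal := ENNReal.toReal_nonneg; positivity
  refine ⟨α / M, by positivity, fun h => ?_⟩
  have h1 : α * (N 0 h + N n h) ≤ ∑ j ∈ Finset.range (n + 1), a j * N j h := by
    have hsub : ∑ j ∈ ({0, n} : Finset ℕ), a j * N j h ≤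
        ∑ j ∈ Finset.range (n + 1), a j * N j h := by
      refine Finset.sum_le_sum_of_subset_of_nonneg ?_ fun j hj _ =>
        mul_nonneg (ha j (by have := Finset.mem_range.1 hj; omega)) (hN j h)
      intro j hj
      simp only [Finset.mem_insert, Finset.mem_singleton] at hj
      rw [Finset.mem_range]
      omega
    rw [Finset.sum_pair (by omega)] at hsub
    refine le_trans ?_ hsub
    rw [mul_add]
    exact add_le_add (mul_le_mul_of_nonneg_right (min_le_left _ _) (hN 0 h))
      (mul_le_mul_of_nonneg_right (min_le_right _ _) (hN n h))
  have h2 : ‖h‖ ^ 2 ≤ M * (N 0 h + N n h) := (hmain h).trans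
    (mul_le_mul_of_nonneg_right (by simp [M]) (add_nonneg (hN 0 h) (hN n h)))
  rw [hLsum]
  calc α / M * ‖h‖ ^ 2 ≤ α / M * (M * (N 0 h + N n h)) := by gcongr
    _ = α * (N 0 h + N n h) := by field_simp
    _ ≤ _ := h1

/-- One step of elliptic regularity for `L̄_c`. -/
theorem sqNorm_ne_top_of_Lbar (n : ℕ) (hn : 2 ≤ n) (a : ℕ → ℝ) (han : a n ≠ 0) {c : H 2 p}
    (hc : c ∈ Imm p) {k : ℤ} (hnk : n ≤ k) (hkp : k < p) (h : H d k)
    (hL : sqNorm (k + 1 - 2 * n) (Lbar n a c h.coeff) ≠ ⊤) : sqNorm (k + 1) h.coeff ≠ ⊤ := by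
  have hp : 2 ≤ p := by omega
  have hs : |p - 1| ≤ p - 1 := by rw [abs_of_nonneg (by omega)]
  have hs1 : 1 ≤ p - 1 := by omega
  have hWR : InversePair (p - 1) (speedFn hp hs c).seq (invSpeed hp hs c).seq :=
    inversePair_of_mul hs1 hs (mul_speedFn_invSpeed hp hs hc) (mul_invSpeed_speedFn hp hs hc)
  set T : ℕ → Coeffs d := fun j => (DsStar c)^[j] (mulFun (speed c) ((Ds c)^[j] h.coeff))
  -- For `j < n` the summand loses at most `2n - 2` orders from `k`, apart from the cap below `p` at
  -- `j = 0`, so it lies in `Hᵏ⁺¹⁻²ⁿ` and can be moved to the right-hand side.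
  have hlow : sqNorm (k + 1 - 2 * n) (∑ j ∈ Finset.range n, a j • T j) ≠ ⊤ := by
    obtain ⟨F, -, hF⟩ := IsSmoothFamily.sum (p := p) (d := d) (k := k) (l := k + 1 - 2 * n)
      (Finset.range n) (T := fun j c u => a j • (DsStar c)^[j] (mulFun (speed c) ((Ds c)^[j] u)))
      fun j hj => by
        have := Finset.mem_range.1 hj
        exact (IsSmoothFamily.summand hp j n (by omega) hnk hkp.le (by omega)
          (by omega)).const_smul (a j)
    have := (F c h).sqNorm_ne_top
    rwa [hF c hc h] at this
  have hTn : sqNorm (k + 1 - 2 * n) (T n) ≠ ⊤ := by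
    have e : T n = (a n)⁻¹ • (Lbar n a c h.coeff + -∑ j ∈ Finset.range n, a j • T j) := by
      rw [Lbar, Finset.sum_range_succ]
      change T n = (a n)⁻¹ • ((∑ j ∈ Finset.range n, a j • T j) + a n • T n +
        -∑ j ∈ Finset.range n, a j • T j)
      rw [add_neg_cancel_comm, inv_smul_smul₀ han]
    rw [e]
    exact sqNorm_const_smul_ne_top (sqNorm_add_ne_top hL (by rwa [sqNorm_neg])) _
  simp only [T] at hTn
  rw [Ds_eq_arcD hp hs hc, DsStar_eq_arcDStar hp hs hc, H.mulFun_speed hp hs hc] at hTn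
  have hD := hWR.iterate_arcD_ne_top n (k := k) (by omega) (by omega) h.sqNorm_ne_top
  have hlev : |k - n| ≤ p - 1 := abs_le.2 ⟨by omega, by omega⟩
  -- The layers `(D_s*)ⁿ`, `|c'|`, `D_sⁿ` are undone from the outside in, gaining `n`, `0` and `n`
  -- orders. The last gain reaches `k + 1 ≤ p`, the limit allowed by coefficients in `Hᵖ⁻¹`.
  have h1 := hWR.of_iterate_arcDStar n hlev (by omega) (by omega) (by omega)
    (hWR.conv_ne_top hlev hD) hTn
  have h2 := hWR.of_conv hlev (abs_le.2 ⟨by omega, by omega⟩) hD h1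
  have h3 := hWR.of_iterate_arcD n (k := k) (by omega) (by omega) (by omega) (by omega)
    h.sqNorm_ne_top h2
  convert h3 using 2
  ring

/-- `L̄_c` is a bijection from `Hᵖ` onto `Hᵖ⁻²ⁿ`. -/
theorem bijective_Lbar (n : ℕ) (hn : 2 ≤ n) (a : ℕ → ℝ) (ha : ∀ k ≤ n, 0 ≤ a k)
    (ha0 : a 0 ≠ 0) (han : a n ≠ 0) (hnp : (n : ℤ) ≤ p) {c : H 2 p} (hc : c ∈ Imm p)
    (L : H d p →L[ℝ] H d (p - 2 * n)) (hL : ∀ h, (L h).coeff = Lbar n a c h.coeff) :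
    Function.Bijective L := by
  obtain ⟨F, -, hF⟩ := IsSmoothFamily.Lbar (d := d) (p := p) (k := n) (l := -n) (by omega) n a
    le_rfl (by omega) hnp (by omega)
  obtain ⟨C, hC, hco⟩ := exists_coercive n hn a ha ha0 han hnp hc (F c) (hF c hc)
  obtain ⟨hinj, hsurj⟩ := bijective_of_coercive (F c) hC hco
  constructor
  · intro u v huv
    -- Injectivity is inherited from the energy space, since `Hᵖ ⊂ Hⁿ` and both operators act by the
    -- same formula on coefficients.
    have e : F c (incl d hnp u) = F c (incl d hnp v) := coeff_injective <| by
      rw [hF c hc, hF c hc, coeff_incl, coeff_incl, ← hL, ← hL, huv]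
    have := congrArg coeff (hinj e)
    rw [coeff_incl, coeff_incl] at this
    exact coeff_injective this
  · intro f
    obtain ⟨h, hh⟩ := hsurj (incl d (by omega) f)
    have hLh : Lbar n a c h.coeff = f.coeff := by rw [← hF c hc, hh, coeff_incl]
    -- The energy solution is lifted one order at a time from `Hⁿ` to `Hᵖ`.
    have hreg : ∀ i : ℕ, (n + i : ℤ) ≤ p → sqNorm (n + i) h.coeff ≠ ⊤ := by
      intro i
      induction i with
      | zero => intro _; simpa using h.sqNorm_ne_top
      | succ i ih =>
        intro hi
        push_cast at hi ⊢
        rw [← add_assoc]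
        have hstep := sqNorm_ne_top_of_Lbar n hn a han hc (k := n + i) (by omega) (by omega)
          (ofCoeff h.coeff h.isReal (ih (by omega)))
        rw [coeff_ofCoeff, hLh] at hstep
        exact hstep (sqNorm_ne_top_mono (by omega) f.sqNorm_ne_top)
    have hp' : sqNorm p h.coeff ≠ ⊤ := by
      have := hreg (p - n).toNat (by omega)
      rwa [show (n : ℤ) + (p - n).toNat = p by omega] at this
    exact ⟨ofCoeff h.coeff h.isReal hp', coeff_injective (by rw [hL, coeff_ofCoeff, hLh])⟩

end

end SobolevCurves

end

/-! ### Smooth inversion of the family `L̄_c`. -/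

theorem lemma3p3 (d n : ℕ) (hn : 2 ≤ n)
    (a : ℕ → ℝ) (ha : ∀ k ≤ n, 0 ≤ a k) (ha0 : a 0 ≠ 0) (han : a n ≠ 0)
    (p : ℤ) (hp : (n : ℤ) ≤ p) :
    ∃ L : SobolevCurves.Imm p →
        (SobolevCurves.H d p ≃L[ℝ] SobolevCurves.H d (p - 2 * (n : ℤ))),
      (∀ (c : SobolevCurves.Imm p) (h : SobolevCurves.H d p),
        (L c h).coeff = SobolevCurves.Lbar n a (c : SobolevCurves.H 2 p) h.coeff) ∧
      ∃ F : SobolevCurves.H 2 p × SobolevCurves.H d (p - 2 * (n : ℤ)) → SobolevCurves.H d p,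
        (∀ (c : SobolevCurves.Imm p) (f : SobolevCurves.H d (p - 2 * (n : ℤ))),
          F ((c : SobolevCurves.H 2 p), f) = (L c).symm f) ∧
        ContDiffOn ℝ ∞ F (SobolevCurves.Imm p ×ˢ Set.univ) := by
  obtain ⟨G, hG, hGL⟩ := SobolevCurves.IsSmoothFamily.Lbar (d := d) (p := p) (k := p)
    (l := p - 2 * n) (by omega) n a hp (by omega) le_rfl le_rfl
  have hbij : ∀ c : SobolevCurves.Imm p, Function.Bijective (G c) := fun c =>
    SobolevCurves.bijective_Lbar n hn a ha ha0 han hp c.2 (G c) (hGL c c.2)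
  let L : SobolevCurves.Imm p →
      (SobolevCurves.H d p ≃L[ℝ] SobolevCurves.H d (p - 2 * (n : ℤ))) := fun c =>
    -- Boundedness of the inverse is the open mapping theorem, which uses completeness of the
    -- Sobolev spaces.
    ContinuousLinearEquiv.ofBijective (G c) (LinearMap.ker_eq_bot.2 (hbij c).1)
      (LinearMap.range_eq_top.2 (hbij c).2)
  have hL : ∀ c : SobolevCurves.Imm p, (L c : _ →L[ℝ] _) = G c := fun c =>
    ContinuousLinearEquiv.coe_ofBijective _ _ _
  -- `ContinuousLinearMap.inverse` is total, with value `0` on noninvertible operators, and is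
  -- smooth at every invertible one. Each `G c` with `c` an immersion is invertible.
  refine ⟨L, fun c h => ?_, fun x => (G x.1).inverse x.2, fun c f => ?_, ?_⟩
  · rw [← hGL c c.2, ← hL]
    rfl
  · simp only [← hL, ContinuousLinearMap.inverse_equiv]
    rfl
  · refine ContDiffOn.clm_apply ?_ contDiff_snd.contDiffOn
    rintro ⟨c, f⟩ ⟨hc, -⟩
    have h1 : ContDiffAt ℝ ∞ ContinuousLinearMap.inverse (G c) := by
      rw [← hL ⟨c, hc⟩]
      exact contDiffAt_map_inverse _
    have h2 : ContDiffWithinAt ℝ ∞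
        (fun x : SobolevCurves.H 2 p × SobolevCurves.H d (p - 2 * (n : ℤ)) => G x.1)
        (SobolevCurves.Imm p ×ˢ Set.univ) (c, f) :=
      (hG c hc).comp (c, f) contDiffWithinAt_fst fun x hx => hx.1
    exact h1.comp_contDiffWithinAt (c, f) h2
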